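/- **Setting.** An *XY-fusion pattern* consists of a finite qubit register $V$ with (possibly overlapping) sets $I,O\subseteq V$ of inputs and outputs, and a finite sequence of commands: preparations $N_i$ of $i\notin I$ in $|+\rangle$; entangling gates $E_{ij}=CZ_{ij}$, $i\ne j$; fusions $F^{\lambda}_{ij}$ with $i\neq j$, $i,j\notin O$, $\lambda\in\{X,Y\}$; destructive measurements $M_i^{\lambda,\alpha}$ of $i\notin O$ in the basis $\{|+_{\lambda,\alpha}\rangle,|-_{\lambda,\alpha}\rangle\}$, with $\lambda\in\{XY,XZ,YZ,X,Y,Z\}$ and $\alpha\in[0,2\pi)$ (irrelevant for Pauli labels), where $|\pm_{XY,\alpha}\rangle=(|0\rangle\pm e^{i\alpha}|1\rangle)/\sqrt2$, $|\pm_{YZ,\alpha}\rangle=(|+\rangle\pm e^{i\alpha}|-\rangle)/\sqrt2$, $|\pm_{XZ,\alpha}\rangle=(|i\rangle\pm e^{i\alpha}|{-i}\rangle)/\sqrt2$; and corrections $[X_i]^t$, $[Z_i]^t$, where $t$ is an $\mathbb F_2$-linear combination of outcomes. A successful fusion $F^\lambda_{ij}$ with outcome $k$ acts (without destroying $i,j$)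 by attaching a fresh qubit in state $|+\rangle$ to $i$ and $j$ by $CZ$ gates and projecting it onto the $k$-th vector of the Pauli-$\lambda$ basis. Every qubit outside $O$ is measured and every qubit of $O$ is an input or is prepared. The pattern is *runnable* if no command acts on a qubit already measured or not yet prepared (a preparation acts on a qubit not yet prepared), each fusion is performed once, and no correction depends on an outcome not yet obtained. A *success branch* is the linear map obtained by fixing all measurement outcomes and fusion outcomes $k$, with every fusion successful. The pattern is *deterministic on success* if all success branches are proportional to one linear map, and *strongly* so if they are equal up to a global phase. It is *stepwise* deterministic on success if, for every single-qubit measurement command, the sequence truncated just after that command, followed by the later corrections (on qubits available at that point) restricted to the outcomes obtained so far, is deterministic on success. *Uniformly* means for all choices of the measurement angles. The *underlying XY-fusion network* has the resource graph on $V$ in which $i,j$ are adjacent iff they are entangled an odd number of times, the sets $I,O$, the multiset $F$ of fusions, and the measurement and fusion labels. Its *target open graph* adds one vertex $v_f$ for each $f\in F$, joined to the two vertices of $f$ and labelled by the label of $f$. Let $W$ be its vertex set, and let $\mathrm{Odd}(K)$ be the set of vertices with an odd number of neighbours in $K$. A *Pauli flow* is a map $p:W\setminus O\to\mathcal P(W\setminus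 I)$ and a strict partial order $<$ on $W$ such that for all $v\in W\setminus O$ and $w\neq v$ (where outputs have no label): 1. if $w\in p(v)$ and $\lambda(w)\notin\{X,Y\}$ then $v<w$; 2. if $w\in\mathrm{Odd}(p(v))$ and $\lambda(w)\notin\{Y,Z\}$ then $v<w$; 3. if $\lambda(w)=Y$ and not $v<w$, then $w\in p(v)\Leftrightarrow w\in\mathrm{Odd}(p(v))$; 4. $\lambda(v)=XY\Rightarrow v\notin p(v)$ and $v\in\mathrm{Odd}(p(v))$; $\lambda(v)=XZ\Rightarrow v\in p(v)$ and $v\in\mathrm{Odd}(p(v))$; $\lambda(v)=YZ\Rightarrow v\in p(v)$ and $v\notin\mathrm{Odd}(p(v))$; $\lambda(v)=X\Rightarrow v\in\mathrm{Odd}(p(v))$; $\lambda(v)=Z\Rightarrow v\in p(v)$; $\lambda(v)=Y\Rightarrow$ exactly one of $v\in p(v)$, $v\in\mathrm{Odd}(p(v))$ holds. An *XY-flow* is a Pauli flow on the target open graph such that, for every $X$-fusion $f$ and every $v\in W\setminus O$ with $v\neq v_f$, $v_f\notin\mathrm{Odd}(p(v))$. **Theorem.** If a runnable XY-fusion pattern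 is uniformly, strongly and stepwise deterministic on success (that is, for all choices of measurement angles it is strongly deterministic on success and stepwise deterministic on success), then its underlying XY-fusion network has an XY-flow. -/

import Mathlib

noncomputable section

/-- Labels of single-qubit measurements: the three planes and the three Pauli bases. -/
inductive MeasLabel
  | XY | XZ | YZ | X | Y | Z

/-- Labels of fusions in an XY-fusion network. -/
inductive FusionLabel
  | X | Y

def FusionLabel.toMeasLabel : FusionLabel → MeasLabel
  | .X => .X
  | .Y => .Y

/-- Measurement angles, elements of `[0, 2π)`. -/
abbrev MeasAngle : Type := Set.Ico (0 : ℝ) (2 * Real.pi)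

def MeasAngle.zero : MeasAngle := ⟨0, le_refl 0, Real.two_pi_pos⟩

/-! ### Labelled open graphs and Pauli flow -/

/-- A labelled open graph `(G, I, O, λ, α)`; `label` and `angle` are defined on the complement
of `O` only. (`angle` is irrelevant at vertices with a Pauli label.) -/
structure LabelledOpenGraph (W : Type*) where
  graph : SimpleGraph W
  inputs : Set W
  outputs : Set W
  label : (w : W) → w ∉ outputs → MeasLabel
  angle : (w : W) → w ∉ outputs → MeasAngle

/-- The odd neighbourhood of `K` in `G`. -/
def oddNbhd {W : Type*} (G : SimpleGraph W) (K : Set W) : Set W :=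
  {u | Odd (G.neighborSet u ∩ K).ncard}

namespace LabelledOpenGraph

variable {W : Type*} (M : LabelledOpenGraph W)

/-- `w` is a non-output vertex with label `l`. -/
def HasLabel (w : W) (l : MeasLabel) : Prop := ∃ h : w ∉ M.outputs, M.label w h = l

/-- `(p, lt)` is a Pauli flow. Only the values of `p` at non-outputs matter. -/
structure IsPauliFlow (p : W → Set W) (lt : W → W → Prop) : Prop where
  strictOrder : IsStrictOrder W lt
  subset_compl_inputs : ∀ v ∉ M.outputs, p v ⊆ M.inputsᶜ
  cond1 : ∀ v ∉ M.outputs, ∀ w ∈ p v,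
    ¬ M.HasLabel w .X → ¬ M.HasLabel w .Y → v ≠ w → lt v w
  cond2 : ∀ v ∉ M.outputs, ∀ w ∈ oddNbhd M.graph (p v),
    ¬ M.HasLabel w .Y → ¬ M.HasLabel w .Z → v ≠ w → lt v w
  cond3 : ∀ v ∉ M.outputs, ∀ w, ¬ lt v w → v ≠ w → M.HasLabel w .Y →
    (w ∈ p v ↔ w ∈ oddNbhd M.graph (p v))
  condXY : ∀ v, M.HasLabel v .XY → v ∉ p v ∧ v ∈ oddNbhd M.graph (p v)
  condXZ : ∀ v, M.HasLabel v .XZ → v ∈ p v ∧ v ∈ oddNbhd M.graph (p v)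
  condYZ : ∀ v, M.HasLabel v .YZ → v ∈ p v ∧ v ∉ oddNbhd M.graph (p v)
  condX : ∀ v, M.HasLabel v .X → v ∈ oddNbhd M.graph (p v)
  condZ : ∀ v, M.HasLabel v .Z → v ∈ p v
  condY : ∀ v, M.HasLabel v .Y →
    (v ∉ p v ∧ v ∈ oddNbhd M.graph (p v)) ∨ (v ∈ p v ∧ v ∉ oddNbhd M.graph (p v))

end LabelledOpenGraph

/-! ### XY-fusion networks and XY-flow -/

/-- An XY-fusion network `(G, I, O, F, λ, α)` on the vertex set `V`. The multiset of fusions is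
a family of pairs of non-output vertices, indexed by `F`. -/
structure XYFusionNetwork (V F : Type*) where
  graph : SimpleGraph V
  inputs : Set V
  outputs : Set V
  ends : F → {v : V // v ∉ outputs} × {v : V // v ∉ outputs}
  label : {v : V // v ∉ outputs} → MeasLabel
  fusionLabel : F → FusionLabel
  angle : {v : V // v ∉ outputs} → MeasAngle

namespace XYFusionNetwork

variable {V F : Type*} (N : XYFusionNetwork V F)

/-- The vertex `v` belongs to the fusion `f`. -/
def Belongs (v : V) (f : F) : Prop := v = (N.ends f).1 ∨ v = (N.ends f).2

/-- The underlying graph of the target open graph: one new vertex `Sum.inr f` for each fusion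
`f`, joined to the vertices that belong to `f`. -/
def targetGraph : SimpleGraph (V ⊕ F) where
  Adj
    | .inl v, .inl w => N.graph.Adj v w
    | .inl v, .inr f => N.Belongs v f
    | .inr f, .inl v => N.Belongs v f
    | .inr _, .inr _ => False
  symm := ⟨by
    rintro (v | f) (w | g) h
    · exact SimpleGraph.Adj.symm (G := N.graph) h
    · exact h
    · exact h
    · exact h⟩
  loopless := ⟨by
    rintro (v | f) h
    · exact N.graph.irrefl h
    · exact h⟩

/-- The target open graph. Fusion vertices carry the (Pauli) label of the fusion. -/
def target : LabelledOpenGraph (V ⊕ F) where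
  graph := N.targetGraph
  inputs := Sum.inl '' N.inputs
  outputs := Sum.inl '' N.outputs
  label
    | .inl v, h => N.label ⟨v, fun hv => h ⟨v, hv, rfl⟩⟩
    | .inr f, _ => (N.fusionLabel f).toMeasLabel
  angle
    | .inl v, h => N.angle ⟨v, fun hv => h ⟨v, hv, rfl⟩⟩
    | .inr _, _ => MeasAngle.zero

/-- An XY-flow is a Pauli flow on the target open graph such that no `X`-fusion vertex lies in
the odd neighbourhood of the correction set of another vertex. -/
structure IsXYFlow (p : V ⊕ F → Set (V ⊕ F)) (lt : V ⊕ F → V ⊕ F → Prop) : Prop where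
  pauliFlow : N.target.IsPauliFlow p lt
  no_fusion_correction : ∀ f : F, N.fusionLabel f = .X →
    ∀ v ∉ N.target.outputs, v ≠ Sum.inr f → Sum.inr f ∉ oddNbhd N.target.graph (p v)

def HasXYFlow : Prop := ∃ p lt, N.IsXYFlow p lt

end XYFusionNetwork

/-! ### XY-fusion patterns -/

/-- An `𝔽₂`-linear combination of outcomes: of single-qubit measurements, the outcomes `k_f` of
fusions, and the success bits `s_f` of fusions. -/
structure Signal (Q F : Type*) where
  meas : Finset Q
  fus : Finset F
  success : Finset F

/-- The commands of an XY-fusion pattern on the register `V` with outputs `O` and fusions `F`.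
The labels and angles of measurements and the qubits and labels of fusions are recorded in the
pattern, because each qubit is measured once and each fusion is performed once. -/
inductive Command (V F : Type*) (O : Finset V)
  | prepare (i : V)
  | entangle (i j : V) (h : i ≠ j)
  | fuse (f : F)
  | measure (i : {v : V // v ∉ O})
  | corrX (i : V) (s : Signal {v : V // v ∉ O} F)
  | corrZ (i : V) (s : Signal {v : V // v ∉ O} F)

/-- The pair of qubits on which an entangling command acts. -/
def Command.edge {V F : Type*} {O : Finset V} : Command V F O → Option (Sym2 V)
  | .entangle i j _ => some s(i, j)
  | _ => none

/-- An XY-fusion pattern on the register `V`; `commands` is listed in order of execution.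
The qubits outside `outputs` are measured, the output qubits are available at the end, and `F`
indexes the fusion commands. -/
structure XYFusionPattern (V F : Type*) where
  inputs : Finset V
  outputs : Finset V
  ends : F → {v : V // v ∉ outputs} × {v : V // v ∉ outputs}
  ends_ne : ∀ f, (ends f).1 ≠ (ends f).2
  fusionLabel : F → FusionLabel
  label : {v : V // v ∉ outputs} → MeasLabel
  angle : {v : V // v ∉ outputs} → MeasAngle
  commands : List (Command V F outputs)
  measured : ∀ i, Command.measure i ∈ commands
  fused : ∀ f, Command.fuse f ∈ commands
  prepared : ∀ i ∈ outputs, i ∈ inputs ∨ Command.prepare i ∈ commands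

namespace XYFusionPattern

variable {V F : Type*} (P : XYFusionPattern V F)

/-- The same pattern with other measurement angles. -/
def withAngles (β : {v : V // v ∉ P.outputs} → MeasAngle) : XYFusionPattern V F :=
  { P with angle := β }

/-- Qubits that are inputs or have been prepared by the commands in `l`. -/
def preparedBy (l : List (Command V F P.outputs)) : Set V :=
  {i | i ∈ P.inputs ∨ Command.prepare i ∈ l}

/-- Qubits that are available after the commands in `l`: prepared and not measured. -/
def live (l : List (Command V F P.outputs)) : Set V :=
  {i | i ∈ P.preparedBy l ∧ ∀ h : i ∉ P.outputs, Command.measure ⟨i, h⟩ ∉ l}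

/-- All outcomes that occur in the signal `s` have been obtained by the commands in `l`. -/
def Available (l : List (Command V F P.outputs)) (s : Signal {v : V // v ∉ P.outputs} F) : Prop :=
  (∀ i ∈ s.meas, Command.measure i ∈ l) ∧ (∀ f ∈ s.fus, Command.fuse f ∈ l) ∧
    (∀ f ∈ s.success, Command.fuse f ∈ l)

/-- The command may be executed after the commands in `l`. -/
def Allowed (l : List (Command V F P.outputs)) : Command V F P.outputs → Prop
  | .prepare i => i ∉ P.preparedBy l
  | .entangle i j _ => i ∈ P.live l ∧ j ∈ P.live l
  | .fuse f => Command.fuse f ∉ l ∧ ((P.ends f).1 : V) ∈ P.live l ∧ ((P.ends f).2 : V) ∈ P.live l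
  | .measure i => (i : V) ∈ P.live l
  | .corrX i s => i ∈ P.live l ∧ P.Available l s
  | .corrZ i s => i ∈ P.live l ∧ P.Available l s

/-- No command acts on a qubit already measured or not yet prepared (except preparations), and
no correction depends on an outcome not yet obtained. -/
def Runnable : Prop :=
  ∀ pre c post, P.commands = pre ++ c :: post → P.Allowed pre c

/-- The underlying XY-fusion network. As `CZ` is an involution, two qubits are adjacent in the
resource graph when they are entangled an odd number of times. -/
def network [DecidableEq V] : XYFusionNetwork V F where
  graph :=
    { Adj := fun i j => i ≠ j ∧ Odd ((P.commands.filterMap Command.edge).count s(i, j))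
      symm := ⟨fun i j h => ⟨h.1.symm, by rw [Sym2.eq_swap]; exact h.2⟩⟩
      loopless := ⟨fun _ h => h.1 rfl⟩ }
  inputs := P.inputs
  outputs := P.outputs
  ends := P.ends
  label := P.label
  fusionLabel := P.fusionLabel
  angle := P.angle

end XYFusionPattern

/-! ### Single-qubit states and operators on the register -/

/-- `(-1)^b` -/
def sgn (b : ZMod 2) : ℂ := if b = 0 then 1 else -1

/-- `(u + (-1)^s e^{iα} v) / √2` for single-qubit states `u`, `v`. -/
def superpose (u v : ZMod 2 → ℂ) (α : ℝ) (s : ZMod 2) : ZMod 2 → ℂ :=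
  fun b => (u b + sgn s * Complex.exp (α * Complex.I) * v b) / (Real.sqrt 2 : ℂ)

/-- The computational basis state `|a⟩`. -/
def ketZ (a : ZMod 2) : ZMod 2 → ℂ := fun b => if b = a then 1 else 0

/-- `|+⟩` for `a = 0` and `|-⟩` for `a = 1`. -/
def ketX (a : ZMod 2) : ZMod 2 → ℂ := superpose (ketZ 0) (ketZ 1) 0 a

/-- `|i⟩` for `a = 0` and `|-i⟩` for `a = 1`. -/
def ketY (a : ZMod 2) : ZMod 2 → ℂ := superpose (ketZ 0) (ketZ 1) (Real.pi / 2) a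

/-- The measurement basis: `|+_{λ,α}⟩` for `s = 0` and `|-_{λ,α}⟩` for `s = 1`. -/
def ket (l : MeasLabel) (α : ℝ) (s : ZMod 2) : ZMod 2 → ℂ :=
  match l with
  | .XY => superpose (ketZ 0) (ketZ 1) α s
  | .YZ => superpose (ketX 0) (ketX 1) α s
  | .XZ => superpose (ketY 0) (ketY 1) α s
  | .X => ketX s
  | .Y => ketY s
  | .Z => ketZ s

/-- State vectors of the register `V`, in the computational basis. A qubit that is not yet
prepared, or has been measured destructively, is kept in the reference state `|0⟩`. -/
abbrev RegState (V : Type*) : Type _ := (V → ZMod 2) → ℂ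

namespace Gate

variable {V : Type*} [DecidableEq V]

/-- The diagonal operator with entries `d`. -/
def diag (d : (V → ZMod 2) → ℂ) : RegState V →ₗ[ℂ] RegState V :=
  LinearMap.pi fun x => d x • LinearMap.proj x

/-- Preparation of qubit `i` in the state `|+⟩`: the operator `|+⟩⟨0|` on `i`. -/
def prepare (i : V) : RegState V →ₗ[ℂ] RegState V :=
  LinearMap.pi fun x => ketX 0 (x i) • LinearMap.proj (Function.update x i 0)

/-- `CZ` on the qubits `i` and `j`. -/
def cz (i j : V) : RegState V →ₗ[ℂ] RegState V := diag fun x => sgn (x i * x j)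

/-- The operator `|0⟩⟨η|` on qubit `i`: project onto `η` and remove the qubit. -/
def project (i : V) (η : ZMod 2 → ℂ) : RegState V →ₗ[ℂ] RegState V :=
  LinearMap.pi fun x => ketZ 0 (x i) •
    ∑ b : ZMod 2, (starRingEnd ℂ (η b)) • LinearMap.proj (Function.update x i b)

/-- The successful fusion of `i` and `j` with outcome `k`: attach a new qubit `f` in the state
`|+⟩` to `i` and `j` by `CZ` gates and project `f` onto the basis vector of outcome `k` of the
Pauli `X` or `Y` basis. Explicitly this is diagonal, and its entry only depends on the parity
of the two qubits. -/
def fuse (i j : V) (l : FusionLabel) (k : ZMod 2) : RegState V →ₗ[ℂ] RegState V :=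
  diag fun x => ∑ b : ZMod 2,
    starRingEnd ℂ (ket l.toMeasLabel 0 k b) * (sgn (b * x i) * sgn (b * x j) * ketX 0 b)

/-- Pauli `X ^ t` on qubit `i`. -/
def pauliX (i : V) (t : ZMod 2) : RegState V →ₗ[ℂ] RegState V :=
  LinearMap.pi fun x => LinearMap.proj (Function.update x i (x i + t))

/-- Pauli `Z ^ t` on qubit `i`. -/
def pauliZ (i : V) (t : ZMod 2) : RegState V →ₗ[ℂ] RegState V := diag fun x => sgn (t * x i)

end Gate

/-- The value of a signal in a success branch, where all success bits `s_f` are `1`. -/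
def Signal.eval {Q F : Type*} (s : Signal Q F) (m : Q → ZMod 2) (k : F → ZMod 2) : ZMod 2 :=
  ∑ i ∈ s.meas, m i + ∑ f ∈ s.fus, k f + ∑ _f ∈ s.success, 1

/-! ### Success branches and determinism -/

namespace XYFusionPattern

variable {V F : Type*} [DecidableEq V] (P : XYFusionPattern V F)

/-- The embedding of the input qubits into the register. -/
def embed : (({i : V // i ∈ P.inputs} → ZMod 2) → ℂ) →ₗ[ℂ] RegState V :=
  open Classical in
  LinearMap.pi fun x =>
    if ∀ i ∉ P.inputs, x i = 0 then
      LinearMap.proj (φ := fun _ => ℂ) (fun i : {i : V // i ∈ P.inputs} => x i) else 0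

/-- The Kraus map of a command when single-qubit measurements have outcomes `m`, all fusions
succeed, and fusions have outcomes `k`. -/
def kraus (m : {v : V // v ∉ P.outputs} → ZMod 2) (k : F → ZMod 2) :
    Command V F P.outputs → (RegState V →ₗ[ℂ] RegState V)
  | .prepare i => Gate.prepare i
  | .entangle i j _ => Gate.cz i j
  | .fuse f => Gate.fuse (P.ends f).1 (P.ends f).2 (P.fusionLabel f) (k f)
  | .measure i => Gate.project i (ket (P.label i) (P.angle i) (m i))
  | .corrX i s => Gate.pauliX i (s.eval m k)
  | .corrZ i s => Gate.pauliZ i (s.eval m k)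

/-- The success branch of the sequence of commands `l` with outcomes `m`, `k`. -/
def branch (l : List (Command V F P.outputs))
    (m : {v : V // v ∉ P.outputs} → ZMod 2) (k : F → ZMod 2) :
    (({i : V // i ∈ P.inputs} → ZMod 2) → ℂ) →ₗ[ℂ] RegState V :=
  l.foldl (fun A c => P.kraus m k c ∘ₗ A) P.embed

/-- Determinism on success of the sequence of commands `l`: all its success branches are
proportional to one linear map. -/
def SuccessBranchesProportional (l : List (Command V F P.outputs)) : Prop :=
  ∃ T, ∀ m k, ∃ c : ℂ, P.branch l m k = c • T

/-- Strong determinism on success: all success branches are equal up to a global phase. -/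
def StronglyDeterministicOnSuccess : Prop :=
  ∃ T, ∀ m k, ∃ c : ℂ, ‖c‖ = 1 ∧ P.branch P.commands m k = c • T

open Classical in
/-- The part of a signal that consists of outcomes obtained by the commands in `l`. -/
def restrictSignal (l : List (Command V F P.outputs)) (s : Signal {v : V // v ∉ P.outputs} F) :
    Signal {v : V // v ∉ P.outputs} F where
  meas := s.meas.filter fun i => Command.measure i ∈ l
  fus := s.fus.filter fun f => Command.fuse f ∈ l
  success := s.success.filter fun f => Command.fuse f ∈ l

open Classical in
/-- A command that is added back after truncation to `l`: the corrections on available qubits,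
as far as they depend on outcomes already obtained. -/
def addedBack (l : List (Command V F P.outputs)) :
    Command V F P.outputs → Option (Command V F P.outputs)
  | .corrX i s => if i ∈ P.live l then some (.corrX i (P.restrictSignal l s)) else none
  | .corrZ i s => if i ∈ P.live l then some (.corrZ i (P.restrictSignal l s)) else none
  | _ => none

/-- Step-wise determinism on success: for each single-qubit measurement command, the sub-pattern
obtained by truncating the sequence after that command, and adding back the corrections that
depend on the outcomes obtained so far, is deterministic on success. -/
def StepwiseDeterministicOnSuccess : Prop :=
  ∀ pre i post, P.commands = pre ++ Command.measure i :: post →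
    P.SuccessBranchesProportional
      ((pre ++ [Command.measure i]) ++
        post.filterMap (P.addedBack (pre ++ [Command.measure i])))

end XYFusionPattern

end

/-!
Let `W` be the vertex set of the target open graph. A correction set for a vertex `v` is sought as
the support of a vector `K` over `𝔽₂`, where `K` stands for the product of the stabilizers
`X_u Z_{N(u)}` over `u` in the set: this operator has to flip the outcome at `v` and to preserve the
outcomes at all vertices that do not come after `v`. In the order used here (`rank`), fusions and
Pauli measurements come first, then the planar measurements in their order of execution, then the
outputs. These conditions on `K` are linear equations, and by duality (`exists_correction`) they are
solvable unless there is an *obstruction*: a Pauli operator `R` on `W` that commutes with the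
stabilizers of all non-inputs, is compatible with the labels of all measurements and fusions, is
trivial after `v`, and anticommutes with the operator flipping the outcome at `v`. The extra
condition of an XY-flow on `X`-fusions holds automatically, because fusion vertices come first.

An obstruction contradicts strong determinism. Commuting with the stabilizers means that `R`
describes a Pauli operator which starts on the inputs, passes through all commands of the pattern
and disappears at the outputs (`IsClosedWeb`, `Runnable.sum_kick_eq_oddSum`). On its way it changes
the angles `β` of planar measurements on which it acts to new angles `β'`, and it picks up a
phase at each command. The phases for the two outcomes at `v` have opposite signs, since `R`
anticommutes with the flip at `v`.

On the other hand, set all angles after `v` to `0`, and compare the two branches `L₀ β` and `L₁ β`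
in which only the outcome at `v` is flipped while all other commands, including the corrections, are
kept fixed. All measurements after `v` are then Pauli measurements, so that `L₁ β` agrees up to a
Pauli operator, which does not depend on `β`, with an actual branch (`exists_run_pauliFrame`).
By strong determinism `L₀ β = γ(β) • C (L₁ β)` with a fixed Pauli operator `C` and `‖γ(β)‖ = 1`
(`exists_flippedRun_eq`), and transporting this equation along `R` gives `γ(β') = -γ(β)`
(`IsWeb.factor_eq_neg`).

If `v` is a fusion or a Pauli measurement, then `R` is trivial on all planar measurements, so
`β' = β`, which is absurd. If `v` is a planar measurement with angle `α`, then
`L₀ = a + e^{-iα} b` and `L₁ = a - e^{-iα} b`, where `a` and `b` do not depend on `α`. Equality of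
norms for all `α` makes `γ` a Laurent polynomial of degree at most one in `e^{-iα}`, and the
equation obtained from replacing `α` by `α + π` shows that `γ ^ 2` is a constant sign
(`sq_mul_eq_one_of_unimodular`). As `γ` is continuous in `β`, it is constant (`factor_eq`), again
a contradiction.
-/

/-! ### Signs and changes of single-qubit bras under Pauli operators -/

@[simp] lemma sgn_zero : sgn 0 = 1 := by simp [sgn]

@[simp] lemma sgn_one : sgn 1 = -1 := by simp [sgn]

lemma zmod_two_cases (c : ZMod 2) : c = 0 ∨ c = 1 := by
  revert c; decide

lemma sgn_add (c d : ZMod 2) : sgn (c + d) = sgn c * sgn d := by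
  have h : (1 + 1 : ZMod 2) = 0 := by decide
  rcases zmod_two_cases c with rfl | rfl <;> rcases zmod_two_cases d with rfl | rfl <;> simp [h]

lemma sgn_mul_self (c : ZMod 2) : sgn c * sgn c = 1 := by
  rcases zmod_two_cases c with rfl | rfl <;> simp

lemma sgn_ne_zero (c : ZMod 2) : sgn c ≠ 0 := by
  rcases zmod_two_cases c with rfl | rfl <;> simp

@[simp] lemma norm_sgn (c : ZMod 2) : ‖sgn c‖ = 1 := by
  rcases zmod_two_cases c with rfl | rfl <;> simp

@[simp] lemma conj_sgn (c : ZMod 2) : (starRingEnd ℂ) (sgn c) = sgn c := by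
  rcases zmod_two_cases c with rfl | rfl <;> simp

lemma ZMod.add_self_two (c : ZMod 2) : c + c = 0 := by
  revert c; decide

/-- `⟨η| Z^b X^a = ρ ⟨η'|` for single-qubit vectors `η`, `η'`. -/
def BraShift (η : ZMod 2 → ℂ) (a b : ZMod 2) (ρ : ℂ) (η' : ZMod 2 → ℂ) : Prop :=
  ∀ c, starRingEnd ℂ (η c) * sgn (b * c) = ρ * starRingEnd ℂ (η' (c + a))

lemma braShift_zero (η : ZMod 2 → ℂ) : BraShift η 0 0 1 η := by
  intro c; simp

lemma braShift_ketZ (s a b : ZMod 2) : BraShift (ketZ s) a b (sgn (b * s)) (ketZ (s + a)) := by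
  intro c
  by_cases h : c = s
  · subst h; simp [ketZ]
  · simp [ketZ, h]

lemma ketX_apply (s c : ZMod 2) : ketX s c = sgn (s * c) / (Real.sqrt 2 : ℂ) := by
  rcases zmod_two_cases c with rfl | rfl <;> simp [ketX, superpose, ketZ]

lemma ketY_apply (s c : ZMod 2) :
    ketY s c = (if c = 0 then 1 else sgn s * Complex.I) / (Real.sqrt 2 : ℂ) := by
  have : Complex.exp ((Real.pi / 2 : ℝ) * Complex.I) = Complex.I := by
    push_cast; exact Complex.exp_pi_div_two_mul_I
  rcases zmod_two_cases c with rfl | rfl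
  · simp [ketY, superpose, ketZ]
  · unfold ketY superpose; rw [this]; simp [ketZ]

lemma braShift_ketX (s a b : ZMod 2) :
    BraShift (ketX s) a b (sgn ((s + b) * a)) (ketX (s + b)) := by
  intro c
  have h1 : sgn ((s + b) * (c + a)) = sgn (s * c) * sgn (b * c) * sgn ((s + b) * a) := by
    rw [← sgn_add, ← sgn_add]; congr 1; ring
  simp only [ketX_apply, map_div₀, conj_sgn, Complex.conj_ofReal]
  rw [h1]
  have := sgn_mul_self ((s + b) * a)
  linear_combination (-(sgn (s * c) * sgn (b * c) / (Real.sqrt 2 : ℂ))) * this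

lemma braShift_ketY (s a b : ZMod 2) :
    BraShift (ketY s) a b (if a = 0 then 1 else -(sgn (s + b) * Complex.I))
      (ketY (s + b + a)) := by
  intro c
  have h : (1 + 1 : ZMod 2) = 0 := by decide
  have h2 := sgn_mul_self s
  have h3 := sgn_mul_self b
  have h4 := Complex.I_mul_I
  rcases zmod_two_cases c with rfl | rfl <;> rcases zmod_two_cases a with rfl | rfl <;>
    simp only [ketY_apply, map_div₀, Complex.conj_ofReal, add_zero, zero_add, if_true,
      one_ne_zero, if_false, map_one, map_neg, mul_zero, mul_one, map_mul, conj_sgn,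
      Complex.conj_I, sgn_add, sgn_zero, sgn_one, h]
  · ring
  · linear_combination (1 / (Real.sqrt 2 : ℂ)) *
      (sgn b * sgn b * Complex.I * Complex.I * h2 + Complex.I * Complex.I * h3 + h4)
  · ring
  · ring

/-- The exponents `(a, b)` of a Pauli operator `X^a Z^b` that exchanges the two outcomes of every
measurement with the given label: the normal direction of a plane, and a choice of an operator
anticommuting with a Pauli label. -/
def MeasLabel.flip : MeasLabel → ZMod 2 × ZMod 2
  | .XY => (0, 1)
  | .XZ => (1, 1)
  | .YZ => (1, 0)
  | .X => (0, 1)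
  | .Y => (0, 1)
  | .Z => (1, 0)

/-- The commutator of `X^a Z^b` with the operator `MeasLabel.flip`: the value is `1` iff the two
operators anticommute. -/
def MeasLabel.pairing : MeasLabel → ZMod 2 × ZMod 2 → ZMod 2
  | .XY, r => r.1
  | .XZ, r => r.1 + r.2
  | .YZ, r => r.2
  | .X, r => r.1
  | .Y, r => r.1
  | .Z, r => r.2

/-- The label is one of the three planes. -/
def MeasLabel.IsPlanar : MeasLabel → Prop
  | .XY | .XZ | .YZ => True
  | .X | .Y | .Z => False

/-- The exponents `(a, b)` for which `X^a Z^b` maps, up to phases, measurement vectors with the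
given label to measurement vectors with the same label and, for Pauli labels, the same outcome. -/
def MeasLabel.compatible : MeasLabel → Submodule (ZMod 2) (ZMod 2 × ZMod 2)
  | .XY | .XZ | .YZ => ⊤
  | .X => LinearMap.ker (LinearMap.snd (ZMod 2) (ZMod 2) (ZMod 2))
  | .Y => LinearMap.ker
      (LinearMap.fst (ZMod 2) (ZMod 2) (ZMod 2) + LinearMap.snd (ZMod 2) (ZMod 2) (ZMod 2))
  | .Z => LinearMap.ker (LinearMap.fst (ZMod 2) (ZMod 2) (ZMod 2))

lemma exists_measAngle_exp {w : ℂ} (hw : ‖w‖ = 1) :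
    ∃ α : MeasAngle, Complex.exp ((α : ℝ) * Complex.I) = w := by
  have h0 : Complex.exp (w.arg * Complex.I) = w := by
    have := Complex.norm_mul_exp_arg_mul_I w
    rw [hw] at this; simpa using this
  refine ⟨⟨toIcoMod Real.two_pi_pos 0 w.arg, ?_⟩, ?_⟩
  · simpa using toIcoMod_mem_Ico Real.two_pi_pos 0 w.arg
  · have : ((toIcoMod Real.two_pi_pos 0 w.arg : ℝ) : ℂ) * Complex.I = w.arg * Complex.I -
        (toIcoDiv Real.two_pi_pos 0 w.arg : ℤ) * (2 * Real.pi * Complex.I) := by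
      have h := toIcoMod_add_toIcoDiv_zsmul Real.two_pi_pos 0 w.arg
      have h' := congrArg (fun x : ℝ => (x : ℂ)) h
      push_cast [zsmul_eq_mul] at h'
      rw [← h']; ring
    simp only [this, Complex.exp_sub, Complex.exp_int_mul_two_pi_mul_I, h0, div_one]

lemma norm_exp_measAngle (α : ℝ) : ‖Complex.exp (α * Complex.I)‖ = 1 :=
  Complex.norm_exp_ofReal_mul_I α

lemma conj_exp_measAngle (α : ℝ) :
    (starRingEnd ℂ) (Complex.exp (α * Complex.I)) = (Complex.exp (α * Complex.I))⁻¹ := by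
  rw [Complex.inv_def, Complex.normSq_eq_norm_sq, norm_exp_measAngle]; simp

/-- A Pauli operator that permutes, up to phases, the two vectors spanning a measurement plane maps
the measurement bases of that plane to each other. The relative phase of the two outcomes changes
sign iff the two spanning vectors are exchanged, that is, iff `d = 1`. -/
lemma braShift_superpose {U : ZMod 2 → ZMod 2 → ℂ} {a b d t : ZMod 2} {r : ℂ} (hr : r ≠ 0)
    (h0 : BraShift (U 0) a b r (U d)) (h1 : BraShift (U 1) a b (r * sgn t) (U (1 + d)))
    (α : MeasAngle) :
    ∃ (α' : MeasAngle) (ρ : ℂ), ρ ≠ 0 ∧ ∀ s,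
      BraShift (superpose (U 0) (U 1) α s) a b (sgn (s * d) * ρ) (superpose (U 0) (U 1) α' s) := by
  set z := Complex.exp ((α : ℝ) * Complex.I) with hz
  have hz0 : z ≠ 0 := Complex.exp_ne_zero _
  have hzc : (starRingEnd ℂ) z = z⁻¹ := conj_exp_measAngle α
  have hnz : ‖z‖ = 1 := norm_exp_measAngle α
  have htt := sgn_mul_self t
  rcases zmod_two_cases d with rfl | rfl
  · obtain ⟨α', hα'⟩ := exists_measAngle_exp (w := sgn t * z) (by simp [hnz])
    refine ⟨α', r, hr, fun s c => ?_⟩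
    have e0 := h0 c
    have e1 := h1 c
    rw [add_zero] at e1
    simp only [superpose, ← hz, hα', map_div₀, map_add, map_mul, conj_sgn, hzc,
      Complex.conj_ofReal, mul_zero, sgn_zero, one_mul]
    linear_combination (1 / (Real.sqrt 2 : ℂ)) * e0 + (sgn s * z⁻¹ / (Real.sqrt 2 : ℂ)) * e1
  · obtain ⟨α', hα'⟩ := exists_measAngle_exp (w := sgn t * z⁻¹) (by simp [hnz])
    refine ⟨α', r * sgn t * z⁻¹, by simp [hr, hz0, sgn_ne_zero], fun s c => ?_⟩
    have e0 := h0 c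
    have e1 := h1 c
    have hss := sgn_mul_self s
    have hzz : z⁻¹ * z = 1 := inv_mul_cancel₀ hz0
    rw [show (1 + 1 : ZMod 2) = 0 by decide] at e1
    simp only [superpose, ← hz, hα', map_div₀, map_add, map_mul, conj_sgn, hzc, map_inv₀, inv_inv,
      Complex.conj_ofReal, mul_one]
    linear_combination (1 / (Real.sqrt 2 : ℂ)) * e0 + (sgn s * z⁻¹ / (Real.sqrt 2 : ℂ)) * e1
      - r * (starRingEnd ℂ) (U 1 (c + a)) / (Real.sqrt 2 : ℂ) *
        (sgn t * sgn t * z⁻¹ * z * hss + z⁻¹ * z * htt + hzz)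

/-- A Pauli operator that is compatible with a label changes the angle of a measurement, but not its
outcome. The relative sign of the phases of the two outcomes is the commutator with
`MeasLabel.flip`. -/
lemma exists_braShift_ket (l : MeasLabel) {a b : ZMod 2} (h : (a, b) ∈ l.compatible)
    (α : MeasAngle) :
    ∃ (α' : MeasAngle) (ρ : ℂ), ρ ≠ 0 ∧ (¬ l.IsPlanar ∨ (a = 0 ∧ b = 0) → α' = α) ∧
      ∀ s, BraShift (ket l α s) a b (sgn (s * l.pairing (a, b)) * ρ) (ket l α' s) := by
  by_cases hab : a = 0 ∧ b = 0
  · obtain ⟨rfl, rfl⟩ := hab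
    refine ⟨α, 1, one_ne_zero, fun _ => rfl, fun s => ?_⟩
    have : l.pairing (0, 0) = 0 := by cases l <;> simp [MeasLabel.pairing]
    simpa [this] using braShift_zero (ket l α s)
  cases l
  · obtain ⟨α', ρ, hρ, H⟩ := braShift_superpose (U := ketZ) (t := b) (r := 1) one_ne_zero
      (by simpa using braShift_ketZ 0 a b) (by simpa using braShift_ketZ 1 a b) α
    exact ⟨α', ρ, hρ, fun h => absurd h (by simp [MeasLabel.IsPlanar, hab]), H⟩
  · have h0 := braShift_ketY 0 a b
    have h1 := braShift_ketY 1 a b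
    obtain ⟨α', ρ, hρ, H⟩ := braShift_superpose (U := ketY) (t := a) (d := a + b)
      (r := if a = 0 then 1 else -(sgn b * Complex.I))
      (by split_ifs <;> simp [sgn_ne_zero]) (by convert h0 using 2 <;> simp [add_comm])
      (by
        convert h1 using 2
        · rcases zmod_two_cases a with rfl | rfl <;> simp [sgn_add]
        · ring) α
    exact ⟨α', ρ, hρ, fun h => absurd h (by simp [MeasLabel.IsPlanar, hab]), H⟩
  · obtain ⟨α', ρ, hρ, H⟩ := braShift_superpose (U := ketX) (t := a) (r := sgn (b * a))
      (sgn_ne_zero _)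
      (by simpa using braShift_ketX 0 a b)
      (by
        have := braShift_ketX 1 a b
        rwa [add_mul, sgn_add, one_mul, mul_comm] at this) α
    exact ⟨α', ρ, hρ, fun h => absurd h (by simp [MeasLabel.IsPlanar, hab]), H⟩
  · have hb : b = 0 := by simpa [MeasLabel.compatible] using h
    subst hb
    exact ⟨α, 1, one_ne_zero, fun _ => rfl, fun s => by
      simpa [MeasLabel.pairing, ket] using braShift_ketX s a 0⟩
  · have hb : a + b = 0 := by simpa [MeasLabel.compatible] using h
    obtain rfl : a = b := by
      rcases zmod_two_cases a with rfl | rfl <;> rcases zmod_two_cases b with rfl | rfl <;>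
        simp_all
    have ha : a = 1 := by rcases zmod_two_cases a with rfl | rfl <;> simp_all
    subst ha
    refine ⟨α, Complex.I, Complex.I_ne_zero, fun _ => rfl, fun s => ?_⟩
    have := braShift_ketY s 1 1
    rw [add_assoc, show (1 + 1 : ZMod 2) = 0 by decide] at this
    simpa [MeasLabel.pairing, sgn_add, ket] using this
  · have ha : a = 0 := by simpa [MeasLabel.compatible] using h
    subst ha
    exact ⟨α, 1, one_ne_zero, fun _ => rfl, fun s => by
      simpa [MeasLabel.pairing, ket, mul_comm] using braShift_ketZ s 0 b⟩

/-- At angle `0` every measurement is a Pauli measurement, so that a Pauli operator permutes the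
two outcomes, up to a phase. -/
lemma exists_braShift_ket_zero (l : MeasLabel) (a b s : ZMod 2) :
    ∃ (s' : ZMod 2) (ρ : ℂ), ‖ρ‖ = 1 ∧ ∀ α : MeasAngle, (l.IsPlanar → α = MeasAngle.zero) →
      BraShift (ket l α s') a b ρ (ket l α s) := by
  have hX : ∃ (s' : ZMod 2) (ρ : ℂ), ‖ρ‖ = 1 ∧ BraShift (ketX s') a b ρ (ketX s) := by
    refine ⟨s + b, sgn (s * a), norm_sgn _, ?_⟩
    have := braShift_ketX (s + b) a b
    rwa [add_assoc, ZMod.add_self_two, add_zero] at this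
  have hY : ∃ (s' : ZMod 2) (ρ : ℂ), ‖ρ‖ = 1 ∧ BraShift (ketY s') a b ρ (ketY s) := by
    have := braShift_ketY (s + b + a) a b
    rw [show s + b + a + b + a = s + (b + b) + (a + a) by ring, ZMod.add_self_two,
      ZMod.add_self_two, add_zero, add_zero] at this
    refine ⟨s + b + a, _, ?_, this⟩
    split_ifs <;> simp
  have hZ : ∃ (s' : ZMod 2) (ρ : ℂ), ‖ρ‖ = 1 ∧ BraShift (ketZ s') a b ρ (ketZ s) := by
    refine ⟨s + a, sgn (b * (s + a)), norm_sgn _, ?_⟩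
    have := braShift_ketZ (s + a) a b
    rwa [add_assoc, ZMod.add_self_two, add_zero] at this
  have hs2 : ((Real.sqrt 2 : ℝ) : ℂ) * (Real.sqrt 2 : ℝ) = 2 := by
    rw [← Complex.ofReal_mul, Real.mul_self_sqrt (by norm_num)]; norm_num
  have hs0 : ((Real.sqrt 2 : ℝ) : ℂ) ≠ 0 := by
    intro h; rw [h] at hs2; norm_num at hs2
  cases l
  · obtain ⟨s', ρ, hρ, H⟩ := hX
    exact ⟨s', ρ, hρ, fun α hα => by rw [hα trivial]; exact H⟩
  · -- at angle `0` the basis of the plane `XZ` is `|0⟩`, `i|1⟩`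
    have key : ∀ t c, superpose (ketY 0) (ketY 1) 0 t c =
        (if t = 0 then 1 else Complex.I) * ketZ t c := by
      intro t c
      simp only [superpose, ketY_apply, ketZ]
      rcases zmod_two_cases t with rfl | rfl <;> rcases zmod_two_cases c with rfl | rfl <;>
        simp <;> field_simp <;> first | ring1 | linear_combination -hs2
    obtain ⟨s', ρ, hρ, H⟩ := hZ
    refine ⟨s', starRingEnd ℂ (if s' = 0 then 1 else Complex.I) * ρ /
      starRingEnd ℂ (if s = 0 then 1 else Complex.I), ?_, fun α hα c => ?_⟩
    · split_ifs <;> simp [hρ]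
    · rw [hα trivial]
      have h0 : starRingEnd ℂ (if s = 0 then 1 else Complex.I) ≠ 0 := by split_ifs <;> simp
      have := H c
      change starRingEnd ℂ (superpose (ketY 0) (ketY 1) 0 s' c) * _ =
        _ * starRingEnd ℂ (superpose (ketY 0) (ketY 1) 0 s _)
      rw [key, key, map_mul, map_mul, mul_assoc, this]
      field_simp
  · have key : ∀ t c, superpose (ketX 0) (ketX 1) 0 t c = ketZ t c := by
      intro t c
      simp only [superpose, ketX_apply, ketZ]
      rcases zmod_two_cases t with rfl | rfl <;> rcases zmod_two_cases c with rfl | rfl <;>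
        simp <;> field_simp <;> first | ring1 | linear_combination -hs2
    obtain ⟨s', ρ, hρ, H⟩ := hZ
    refine ⟨s', ρ, hρ, fun α hα c => ?_⟩
    rw [hα trivial]
    change starRingEnd ℂ (superpose (ketX 0) (ketX 1) 0 s' c) * _ =
        _ * starRingEnd ℂ (superpose (ketX 0) (ketX 1) 0 s _)
    rw [key, key]
    exact H c
  · obtain ⟨s', ρ, hρ, H⟩ := hX
    exact ⟨s', ρ, hρ, fun _ _ => H⟩
  · obtain ⟨s', ρ, hρ, H⟩ := hY
    exact ⟨s', ρ, hρ, fun _ _ => H⟩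
  · obtain ⟨s', ρ, hρ, H⟩ := hZ
    exact ⟨s', ρ, hρ, fun _ _ => H⟩

/-! ### Pauli operators on the register -/

namespace Gate

lemma diag_apply {V : Type*} (d : (V → ZMod 2) → ℂ) (ψ : RegState V) (x : V → ZMod 2) :
    diag d ψ x = d x * ψ x := by
  simp [diag]

lemma project_apply {V : Type*} [DecidableEq V] (i : V) (η : ZMod 2 → ℂ) (ψ : RegState V)
    (x : V → ZMod 2) :
    project i η ψ x =
      ketZ 0 (x i) * ∑ c, starRingEnd ℂ (η c) * ψ (Function.update x i c) := by
  simp [project]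

end Gate

section Frames

variable {V : Type*} [Fintype V]

/-- The Pauli operator `Z^b X^a` on the register. -/
def pauliFrame (a b : V → ZMod 2) : RegState V →ₗ[ℂ] RegState V :=
  LinearMap.pi fun x => sgn (∑ i, b i * x i) • LinearMap.proj (x + a)

lemma pauliFrame_apply (a b : V → ZMod 2) (ψ : RegState V) (x : V → ZMod 2) :
    pauliFrame a b ψ x = sgn (∑ i, b i * x i) * ψ (x + a) := by
  simp [pauliFrame]

lemma pauliFrame_zero : pauliFrame (0 : V → ZMod 2) 0 = LinearMap.id := by
  ext ψ x; simp [pauliFrame_apply]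

lemma pauliFrame_pauliFrame (a b : V → ZMod 2) (ψ : RegState V) :
    pauliFrame a b (pauliFrame a b ψ) = sgn (∑ i, b i * a i) • ψ := by
  funext x
  have h : x + a + a = x := by
    rw [add_assoc, show a + a = 0 from funext fun i => ZMod.add_self_two _, add_zero]
  simp only [pauliFrame_apply, h, Pi.smul_apply, smul_eq_mul, Pi.add_apply, mul_add,
    Finset.sum_add_distrib, sgn_add]
  linear_combination (sgn (∑ i, b i * a i) * ψ x) * sgn_mul_self (∑ i, b i * x i)

variable [DecidableEq V]

lemma sum_normSq_pauliFrame (a b : V → ZMod 2) (ψ : RegState V) :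
    ∑ x, ‖pauliFrame a b ψ x‖ ^ 2 = ∑ x, ‖ψ x‖ ^ 2 := by
  simp only [pauliFrame_apply, norm_mul, norm_sgn, one_mul]
  exact Equiv.sum_comp (Equiv.addRight a) (fun x => ‖ψ x‖ ^ 2)

lemma sum_single_mul (i : V) (t : ZMod 2) (x : V → ZMod 2) :
    ∑ j, (Pi.single i t : V → ZMod 2) j * x j = t * x i := by
  rw [Finset.sum_eq_single i]
  · simp
  · intro j _ h; simp [h]
  · simp

lemma sum_mul_update (b x : V → ZMod 2) (i : V) (c : ZMod 2) :
    ∑ j, b j * Function.update x i c j = ∑ j, Function.update b i 0 j * x j + b i * c := by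
  rw [← Finset.add_sum_erase _ _ (Finset.mem_univ i), ← Finset.add_sum_erase _
    (fun j => Function.update b i 0 j * x j) (Finset.mem_univ i)]
  simp only [Function.update_self, zero_mul, zero_add]
  rw [add_comm]
  congr 1
  refine Finset.sum_congr rfl fun j hj => ?_
  have := Finset.ne_of_mem_erase hj
  simp [Function.update_of_ne this]

namespace Gate

lemma cz_pauliFrame (i j : V) (a b : V → ZMod 2) (ψ : RegState V) :
    cz i j (pauliFrame a b ψ) = sgn (a i * a j) •
      pauliFrame a (b + (Pi.single i (a j) + Pi.single j (a i))) (cz i j ψ) := by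
  funext x
  simp only [cz, diag_apply, pauliFrame_apply, Pi.smul_apply, smul_eq_mul, Pi.add_apply, add_mul,
    Finset.sum_add_distrib, sum_single_mul]
  have : x i * x j = a i * a j + (a j * x i + a i * x j) + (x i + a i) * (x j + a j) := by
    linear_combination -(ZMod.add_self_two (a i * a j)) - ZMod.add_self_two (x i * a j)
      - ZMod.add_self_two (a i * x j)
  rw [this, ← mul_assoc, ← mul_assoc, ← mul_assoc]
  congr 1
  simp only [← sgn_add]
  congr 1; ring

lemma pauliX_pauliFrame (i : V) (t : ZMod 2) (a b : V → ZMod 2) (ψ : RegState V) :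
    pauliX i t (pauliFrame a b ψ) = sgn (b i * t) • pauliFrame a b (pauliX i t ψ) := by
  funext x
  have hu : ∀ y : V → ZMod 2, Function.update y i (y i + t) = y + Pi.single i t := by
    intro y; funext j
    by_cases h : j = i
    · subst h; simp
    · simp [h]
  simp only [pauliX, LinearMap.pi_apply, LinearMap.proj_apply, pauliFrame_apply, hu,
    Pi.smul_apply, smul_eq_mul, Pi.add_apply, mul_add, Finset.sum_add_distrib, sgn_add]
  have : ∑ j, b j * (Pi.single i t : V → ZMod 2) j = b i * t := by
    simp_rw [mul_comm (b _)]; rw [sum_single_mul]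
  rw [this, add_right_comm x]; ring

lemma pauliX_add_pauliFrame (i : V) (t u : ZMod 2) (a b : V → ZMod 2) (ψ : RegState V) :
    pauliX i (t + u) (pauliFrame a b ψ) =
      sgn (b i * (t + u)) • pauliFrame (a + Pi.single i u) b (pauliX i t ψ) := by
  rw [pauliX_pauliFrame]
  congr 1
  funext x
  simp only [pauliX, LinearMap.pi_apply, LinearMap.proj_apply, pauliFrame_apply]
  congr 2
  funext j
  by_cases h : j = i
  · subst h; simp; ring
  · simp [h]

omit [DecidableEq V] in
lemma pauliZ_pauliFrame (i : V) (t : ZMod 2) (a b : V → ZMod 2) (ψ : RegState V) :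
    pauliZ i t (pauliFrame a b ψ) = sgn (t * a i) • pauliFrame a b (pauliZ i t ψ) := by
  funext x
  simp only [pauliZ, diag_apply, pauliFrame_apply, Pi.smul_apply, smul_eq_mul, Pi.add_apply,
    mul_add, sgn_add]
  linear_combination -(sgn (t * x i) * sgn (∑ j, b j * x j) * ψ (x + a)) * sgn_mul_self (t * a i)

lemma pauliZ_add_pauliFrame (i : V) (t u : ZMod 2) (a b : V → ZMod 2) (ψ : RegState V) :
    pauliZ i (t + u) (pauliFrame a b ψ) =
      sgn (t * a i) • pauliFrame a (b + Pi.single i u) (pauliZ i t ψ) := by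
  funext x
  simp only [pauliZ, diag_apply, pauliFrame_apply, Pi.smul_apply, smul_eq_mul, Pi.add_apply,
    mul_add, add_mul, sgn_add, Finset.sum_add_distrib, sum_single_mul]
  linear_combination -(sgn (t * x i) * sgn (u * x i) * sgn (∑ j, b j * x j) * ψ (x + a)) *
    sgn_mul_self (t * a i)

lemma prepare_pauliFrame (i : V) (t : ZMod 2) (a b : V → ZMod 2) (ha : a i = 0) (ψ : RegState V) :
    prepare i (pauliFrame a b ψ) =
      pauliFrame (Function.update a i t) (Function.update b i 0) (prepare i ψ) := by
  funext x
  simp only [prepare, LinearMap.pi_apply, LinearMap.smul_apply, LinearMap.proj_apply,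
    pauliFrame_apply, smul_eq_mul, sum_mul_update, mul_zero, add_zero, ketX_apply, zero_mul]
  have : Function.update x i 0 + a = Function.update (x + Function.update a i t) i 0 := by
    funext j
    by_cases h : j = i
    · subst h; simp [ha]
    · simp [h]
  rw [this]; ring

lemma project_pauliFrame {i : V} {a b : V → ZMod 2} {η η' : ZMod 2 → ℂ} {ρ : ℂ}
    (h : BraShift η (a i) (b i) ρ η') (ψ : RegState V) :
    project i η (pauliFrame a b ψ) =
      ρ • pauliFrame (Function.update a i 0) (Function.update b i 0) (project i η' ψ) := by
  funext x
  have hx : (x + Function.update a i 0) i = x i := by simp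
  simp only [project_apply, pauliFrame_apply, Pi.smul_apply, smul_eq_mul, sum_mul_update, sgn_add,
    hx]
  have key : ∀ c, Function.update x i c + a =
      Function.update (x + Function.update a i 0) i (c + a i) := by
    intro c; funext j
    by_cases h : j = i
    · subst h; simp
    · simp [h]
  rw [← Equiv.sum_comp (Equiv.addRight (a i)) (fun c => starRingEnd ℂ (η' c) *
    ψ (Function.update (x + Function.update a i 0) i c))]
  simp only [Equiv.coe_addRight, Finset.mul_sum]
  refine Finset.sum_congr rfl fun c _ => ?_
  rw [key]
  linear_combination (ketZ 0 (x i) * sgn (∑ j, Function.update b i 0 j * x j) *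
    ψ (Function.update (x + Function.update a i 0) i (c + a i))) * h c

/-- The diagonal entry of a successful fusion, as a function of the sum of the outcome and the
parity of the two qubits. -/
noncomputable def fuseEntry (l : FusionLabel) (q : ZMod 2) : ℂ :=
  match l with
  | .X => if q = 0 then 1 else 0
  | .Y => (1 - sgn q * Complex.I) / 2

omit [Fintype V] [DecidableEq V] in
lemma fuse_apply (i j : V) (l : FusionLabel) (k : ZMod 2) (ψ : RegState V) (x : V → ZMod 2) :
    fuse i j l k ψ x = fuseEntry l (k + (x i + x j)) * ψ x := by
  have hs2 : ((Real.sqrt 2 : ℝ) : ℂ) * (Real.sqrt 2 : ℝ) = 2 := by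
    rw [← Complex.ofReal_mul, Real.mul_self_sqrt (by norm_num)]; norm_num
  have hs0 : ((Real.sqrt 2 : ℝ) : ℂ) ≠ 0 := by
    intro h; rw [h] at hs2; norm_num at hs2
  have h11 : (1 + 1 : ZMod 2) = 0 := by decide
  have huniv : (Finset.univ : Finset (ZMod 2)) = {0, 1} := by decide
  simp only [fuse, diag_apply]
  congr 1
  rw [huniv, Finset.sum_pair (by decide)]
  generalize x i = p
  generalize x j = q
  cases l
  · simp only [FusionLabel.toMeasLabel, ket, ketX_apply, fuseEntry]
    rcases zmod_two_cases k with rfl | rfl <;> rcases zmod_two_cases p with rfl | rfl <;>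
      rcases zmod_two_cases q with rfl | rfl <;>
      simp [h11] <;> field_simp <;> first | ring1 | linear_combination -hs2
  · simp only [FusionLabel.toMeasLabel, ket, ketX_apply, ketY_apply, fuseEntry]
    rcases zmod_two_cases k with rfl | rfl <;> rcases zmod_two_cases p with rfl | rfl <;>
      rcases zmod_two_cases q with rfl | rfl <;>
      simp [h11] <;> field_simp <;>
      first | linear_combination (-1 + Complex.I) * hs2 | linear_combination (-1 - Complex.I) * hs2

omit [DecidableEq V] in
/-- Shifting both the qubits and the outcome leaves a fusion unchanged. -/
lemma fuse_outcome_pauliFrame (i j : V) (l : FusionLabel) (k : ZMod 2) (a b : V → ZMod 2)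
    (ψ : RegState V) :
    fuse i j l (k + (a i + a j)) (pauliFrame a b ψ) = pauliFrame a b (fuse i j l k ψ) := by
  funext x
  simp only [fuse_apply, pauliFrame_apply, Pi.add_apply]
  rw [show k + (a i + a j) + (x i + x j) = k + (x i + a i + (x j + a j)) by ring]
  ring

/-- A Pauli operator on the two fused qubits which, together with `X^t` on the fusion qubit, is
compatible with the fusion label is changed by `(Z ⊗ Z)^t` in passing the fusion. -/
lemma exists_fuse_pauliFrame (i j : V) (l : FusionLabel) (a b : V → ZMod 2) (t : ZMod 2)
    (h : (t, a i + a j) ∈ l.toMeasLabel.compatible) :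
    ∃ ρ : ℂ, ρ ≠ 0 ∧ ∀ (k : ZMod 2) (ψ : RegState V), fuse i j l k (pauliFrame a b ψ) =
      (sgn (k * l.toMeasLabel.pairing (t, a i + a j)) * ρ) •
        pauliFrame a (b + (Pi.single i t + Pi.single j t)) (fuse i j l k ψ) := by
  suffices H : ∃ ρ : ℂ, ρ ≠ 0 ∧ ∀ k q : ZMod 2, fuseEntry l (k + q) =
      sgn (k * t) * ρ * sgn (t * q) * fuseEntry l (k + (q + (a i + a j))) by
    obtain ⟨ρ, hρ, H⟩ := H
    refine ⟨ρ, hρ, fun k ψ => ?_⟩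
    have ht : l.toMeasLabel.pairing (t, a i + a j) = t := by
      cases l <;> simp [MeasLabel.pairing, FusionLabel.toMeasLabel]
    funext x
    simp only [fuse_apply, pauliFrame_apply, Pi.smul_apply, smul_eq_mul, Pi.add_apply, add_mul,
      Finset.sum_add_distrib, sum_single_mul, sgn_add, ht]
    rw [H, show x i + a i + (x j + a j) = x i + x j + (a i + a j) by ring, mul_add t, sgn_add]
    ring
  generalize a i + a j = r at h
  have h11 : (1 + 1 : ZMod 2) = 0 := by decide
  cases l
  · have hr : r = 0 := by simpa [MeasLabel.compatible, FusionLabel.toMeasLabel] using h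
    subst hr
    refine ⟨1, one_ne_zero, fun k q => ?_⟩
    rcases zmod_two_cases k with rfl | rfl <;> rcases zmod_two_cases q with rfl | rfl <;>
      simp [fuseEntry, h11, sgn_mul_self]
  · have hb : t + r = 0 := by simpa [MeasLabel.compatible, FusionLabel.toMeasLabel] using h
    obtain rfl : t = r := by
      rw [← add_zero t, ← ZMod.add_self_two r, ← add_assoc, hb, zero_add]
    have hI := Complex.I_mul_I
    rcases zmod_two_cases t with rfl | rfl
    · exact ⟨1, one_ne_zero, fun k q => by simp⟩
    · refine ⟨-Complex.I, by simp, fun k q => ?_⟩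
      rcases zmod_two_cases k with rfl | rfl <;> rcases zmod_two_cases q with rfl | rfl <;>
        simp [fuseEntry, h11] <;> linear_combination (1 / 2) * hI

end Gate

end Frames

/-! ### Unimodular factors -/

section Unimodular

open Matrix

variable {Y : Type*} [Fintype Y]

open scoped ComplexOrder in
lemma star_dotProduct_self_ne_zero {u : Y → ℂ} (hu : u ≠ 0) : star u ⬝ᵥ u ≠ 0 :=
  fun h => hu (dotProduct_star_self_eq_zero.mp h)

/-- If the families `a + z b` and `a - z b`, with `z` on the unit circle, are related by a fixed
isometry `C` up to phases `c z`, and `C ^ 2` is the scalar `γ`, then `(c z) ^ 2 = γ⁻¹`. Indeed `c z`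
is a Laurent polynomial of degree at most one, and `c z * c (-z) = γ⁻¹` leaves only its constant
term. -/
lemma sq_mul_eq_one_of_unimodular {C : (Y → ℂ) →ₗ[ℂ] (Y → ℂ)} {γ : ℂ}
    (hC : ∀ ψ, C (C ψ) = γ • ψ) (hC' : ∀ ψ, star (C ψ) ⬝ᵥ C ψ = star ψ ⬝ᵥ ψ) {a b : Y → ℂ}
    (h0 : ∀ z : ℂ, ‖z‖ = 1 → a + z • b ≠ 0)
    (h : ∀ z : ℂ, ‖z‖ = 1 → ∃ c : ℂ, ‖c‖ = 1 ∧ a + z • b = c • C (a - z • b))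
    {z : ℂ} (hz : ‖z‖ = 1) {c : ℂ} (hc : a + z • b = c • C (a - z • b)) : c ^ 2 * γ = 1 := by
  have conj_mul : ∀ w : ℂ, ‖w‖ = 1 → starRingEnd ℂ w * w = 1 := by
    intro w hw; rw [← Complex.normSq_eq_conj_mul_self, Complex.normSq_eq_norm_sq, hw]; simp
  have norm_eq : ∀ w : ℂ, ‖w‖ = 1 →
      star (a + w • b) ⬝ᵥ (a + w • b) = star (a - w • b) ⬝ᵥ (a - w • b) := by
    intro w hw
    obtain ⟨d, hd, e⟩ := h w hw
    rw [e, star_smul, smul_dotProduct, dotProduct_smul, smul_eq_mul, smul_eq_mul, hC', ← mul_assoc]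
    have := conj_mul d hd
    rw [starRingEnd_apply] at this
    rw [this, one_mul]
  have expand : ∀ w : ℂ, ‖w‖ = 1 → w * (star a ⬝ᵥ b) + starRingEnd ℂ w * (star b ⬝ᵥ a) = 0 := by
    intro w hw
    have := norm_eq w hw
    simp only [star_add, star_sub, star_smul, add_dotProduct, sub_dotProduct, dotProduct_add,
      dotProduct_sub, smul_dotProduct, dotProduct_smul, smul_eq_mul] at this
    rw [starRingEnd_apply]
    linear_combination (1 / 2) * this
  have e1 := expand 1 (by simp)
  have eI := expand Complex.I (by simp)
  have hII := Complex.I_mul_I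
  simp only [map_one, one_mul, Complex.conj_I] at e1 eI
  have hab : star a ⬝ᵥ b = 0 := by
    linear_combination (1 / 2) * e1 - (1 / 2) * Complex.I * eI
      + (1 / 2) * (star a ⬝ᵥ b - star b ⬝ᵥ a) * hII
  have hba : star b ⬝ᵥ a = 0 := by linear_combination e1 - hab
  set N := star a ⬝ᵥ a + star b ⬝ᵥ b with hN
  have norm_sub : ∀ w : ℂ, ‖w‖ = 1 → star (a - w • b) ⬝ᵥ (a - w • b) = N := by
    intro w hw
    have := conj_mul w hw
    rw [starRingEnd_apply] at this
    simp only [star_sub, star_smul, sub_dotProduct, dotProduct_sub, smul_dotProduct,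
      dotProduct_smul, smul_eq_mul, hab, hba]
    rw [hN]
    linear_combination (star b ⬝ᵥ b) * this
  have hN0 : N ≠ 0 := by
    have h1 := h0 1 (by simp)
    rw [← norm_sub 1 (by simp), ← norm_eq 1 (by simp)]
    exact star_dotProduct_self_ne_zero h1
  set A := star (C a) ⬝ᵥ b
  set D := star (C b) ⬝ᵥ a
  set B := star (C a) ⬝ᵥ a - star (C b) ⬝ᵥ b with hB
  have coeff : ∀ w : ℂ, ‖w‖ = 1 → ∀ d : ℂ, a + w • b = d • C (a - w • b) →
      d * N = B + (w * A - starRingEnd ℂ w * D) := by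
    intro w hw d hd
    have e : star (C (a - w • b)) ⬝ᵥ (a + w • b) = d * N := by
      rw [hd, dotProduct_smul, hC', norm_sub w hw, smul_eq_mul]
    rw [← e]
    have := conj_mul w hw
    rw [starRingEnd_apply] at this ⊢
    simp only [map_sub, map_smul, star_sub, star_smul, sub_dotProduct, dotProduct_add,
      smul_dotProduct, dotProduct_smul, smul_eq_mul]
    rw [hB]
    linear_combination (-(star (C b) ⬝ᵥ b)) * this
  have pair : ∀ w : ℂ, ‖w‖ = 1 → ∀ d : ℂ, a + w • b = d • C (a - w • b) →
      ∃ d' : ℂ, d' * N = B - (w * A - starRingEnd ℂ w * D) ∧ d * d' * γ = 1 := by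
    intro w hw d hd
    obtain ⟨d', -, hd'⟩ := h (-w) (by simpa using hw)
    refine ⟨d', ?_, ?_⟩
    · rw [coeff (-w) (by simpa using hw) d' hd', map_neg]; ring
    · have e : a + w • b = (d * d' * γ) • (a + w • b) := by
        have h2 : a - w • b = d' • C (a + w • b) := by
          rw [neg_smul, ← sub_eq_add_neg, sub_neg_eq_add] at hd'
          exact hd'
        calc a + w • b = d • C (d' • C (a + w • b)) := by rw [← h2]; exact hd
          _ = (d * d' * γ) • (a + w • b) := by
            rw [map_smul, hC, smul_smul, smul_smul, mul_assoc]
      by_contra hne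
      have : (1 - d * d' * γ) • (a + w • b) = 0 := by
        rw [sub_smul, one_smul, ← e, sub_self]
      rcases smul_eq_zero.mp this with h3 | h3
      · exact hne (by linear_combination -h3)
      · exact h0 w hw h3
  have quad : ∀ w : ℂ, ‖w‖ = 1 → (w * A - starRingEnd ℂ w * D) ^ 2 * γ = B ^ 2 * γ - N ^ 2 := by
    intro w hw
    obtain ⟨d, -, hd⟩ := h w hw
    obtain ⟨d', h1, h2⟩ := pair w hw d hd
    have h3 := coeff w hw d hd
    linear_combination (-N ^ 2) * h2 + γ * d' * N * h3
      + (B + (w * A - starRingEnd ℂ w * D)) * γ * h1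
  have hγ : γ ≠ 0 := by
    obtain ⟨d, -, hd⟩ := h z hz
    obtain ⟨d', h1, h2⟩ := pair z hz d hd
    rintro rfl; simp at h2
  -- evaluation at `1`, `I` and a square root of `I` shows that `A = D = 0`
  obtain ⟨r, hr⟩ : ∃ r : ℂ, r ^ 2 = Complex.I :=
    IsAlgClosed.exists_pow_nat_eq _ two_pos
  have hrn : ‖r‖ = 1 := by
    have : ‖r‖ ^ 2 = 1 := by rw [← norm_pow, hr]; simp
    nlinarith [norm_nonneg r]
  have hrc : (starRingEnd ℂ r) ^ 2 = -Complex.I := by rw [← map_pow, hr, Complex.conj_I]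
  have q1 := quad 1 (by simp)
  have qI := quad Complex.I (by simp)
  have qr := quad r hrn
  simp only [map_one, one_mul, Complex.conj_I] at q1 qI
  have hAD : A ^ 2 + D ^ 2 = 0 := by
    have : (A ^ 2 + D ^ 2) * γ = 0 := by
      linear_combination (1 / 2) * q1 - (1 / 2) * qI + (1 / 2) * (A + D) ^ 2 * γ * hII
    exact (mul_eq_zero.mp this).resolve_right hγ
  have hAD' : A ^ 2 - D ^ 2 = 0 := by
    have : Complex.I * (A ^ 2 - D ^ 2) * γ = 0 := by
      linear_combination qr - q1 + γ * hAD - A ^ 2 * γ * hr - D ^ 2 * γ * hrc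
        + 2 * A * D * γ * conj_mul r hrn
    simpa [hγ] using this
  have hA : A = 0 := by
    have : A ^ 2 = 0 := by linear_combination (1 / 2) * hAD + (1 / 2) * hAD'
    simpa using this
  have hD : D = 0 := by
    have : D ^ 2 = 0 := by linear_combination (1 / 2) * hAD - (1 / 2) * hAD'
    simpa using this
  obtain ⟨d', h1, h2⟩ := pair z hz c hc
  have h3 := coeff z hz c hc
  have h4 : d' = c := by
    apply mul_right_cancel₀ hN0
    rw [h1, h3, hA, hD]; ring
  rw [h4] at h2
  rw [sq]; exact h2

/-- A continuous family of factors with constant square on a connected space is constant. -/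
lemma factor_eq_of_sq_eq {X : Type*} [TopologicalSpace X] [PreconnectedSpace X]
    {u w : X → Y → ℂ} (hu : Continuous u) (hw : Continuous w) (hw0 : ∀ x, w x ≠ 0) {c : X → ℂ}
    (h : ∀ x, u x = c x • w x) {g : ℂ} (hg : g ≠ 0) (hc : ∀ x, c x ^ 2 = g) (x y : X) :
    c x = c y := by
  have hcont : Continuous c := by
    have e : c = fun x => (star (w x) ⬝ᵥ u x) / (star (w x) ⬝ᵥ w x) := by
      funext x
      rw [h x, dotProduct_smul, smul_eq_mul,
        mul_div_cancel_right₀ _ (star_dotProduct_self_ne_zero (hw0 x))]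
    rw [e]
    exact (hw.star.dotProduct hu).div (hw.star.dotProduct hw)
      fun x => star_dotProduct_self_ne_zero (hw0 x)
  have hc0 : c x ≠ 0 := by
    intro h0; apply hg; rw [← hc x, h0]; simp
  rcases isPreconnected_univ.eq_or_eq_neg_of_sq_eq (f := c) (g := fun _ => c x)
    hcont.continuousOn continuousOn_const (fun y _ => by simp [hc]) (fun _ => hc0) with h1 | h1
  · exact (h1 (Set.mem_univ y)).symm
  · have := h1 (Set.mem_univ x)
    simp only [Pi.neg_apply] at this
    exact absurd (self_eq_neg.mp this) hc0

end Unimodular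

/-! ### Correction sets and Pauli operators commuting with the stabilizers -/

section Duality

open Classical in
/-- The sum over `𝔽₂` of the values of `K` at the neighbours of `u`. -/
noncomputable def oddSum {W : Type*} [Fintype W] (G : SimpleGraph W) (K : W → ZMod 2) (u : W) :
    ZMod 2 :=
  ∑ w, if G.Adj u w then K w else 0

variable {W : Type*} [Fintype W]

lemma mem_oddNbhd_iff (G : SimpleGraph W) (K : W → ZMod 2) (u : W) :
    u ∈ oddNbhd G {w | K w = 1} ↔ oddSum G K u = 1 := by
  classical
  have h1 : oddSum G K u = ((Finset.univ.filter fun w => G.Adj u w ∧ K w = 1).card : ZMod 2) := by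
    rw [Finset.card_filter, oddSum]
    push_cast
    refine Finset.sum_congr rfl fun w _ => ?_
    rcases zmod_two_cases (K w) with h | h <;> simp [h]
  have h2 : (G.neighborSet u ∩ {w | K w = 1}) =
      ((Finset.univ.filter fun w => G.Adj u w ∧ K w = 1 : Finset W) : Set W) := by
    ext w; simp
  rw [oddNbhd, Set.mem_ofPred_eq, h2, Set.ncard_coe_finset, h1, ZMod.natCast_eq_one_iff_odd]

lemma oddSum_comm (G : SimpleGraph W) (A K : W → ZMod 2) :
    ∑ u, A u * oddSum G K u = ∑ u, oddSum G A u * K u := by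
  unfold oddSum
  simp only [Finset.mul_sum, Finset.sum_mul]
  rw [Finset.sum_comm]
  refine Finset.sum_congr rfl fun u _ => Finset.sum_congr rfl fun w _ => ?_
  by_cases h : G.Adj u w
  · rw [if_pos h, if_pos h.symm]
  · rw [if_neg h, if_neg fun h' => h h'.symm]; ring

/-- Linear duality over `𝔽₂`. Suppose that every Pauli operator `∏ X^{a_u} Z^{b_u}` with
`(a_u, b_u) ∈ L u` which commutes with all stabilizers `X_u Z_{N(u)}`, `u ∉ I`, also commutes with
`∏ X^{e_u.1} Z^{e_u.2}`. Then some product of these stabilizers has the same commutation relations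
as this operator with all Pauli operators of the first kind. -/
lemma exists_correction (G : SimpleGraph W) (I : Set W)
    (L : W → Submodule (ZMod 2) (ZMod 2 × ZMod 2)) (e : W → ZMod 2 × ZMod 2)
    (h : ∀ R : W → ZMod 2 × ZMod 2, (∀ u, R u ∈ L u) →
      (∀ u ∉ I, (R u).2 = oddSum G (fun w => (R w).1) u) →
      ∑ u, ((R u).1 * (e u).2 + (R u).2 * (e u).1) = 0) :
    ∃ K : W → ZMod 2, (∀ u ∈ I, K u = 0) ∧ ∀ u, ∀ r ∈ L u,
      r.1 * oddSum G K u + r.2 * K u = r.1 * (e u).2 + r.2 * (e u).1 := by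
  classical
  let E := Submodule.pi Set.univ L
  let ev : (W → ZMod 2 × ZMod 2) → E →ₗ[ZMod 2] ZMod 2 := fun f =>
    { toFun := fun R => ∑ u, ((R.1 u).1 * (f u).2 + (R.1 u).2 * (f u).1)
      map_add' := fun R S => by
        rw [← Finset.sum_add_distrib]
        refine Finset.sum_congr rfl fun u _ => ?_
        simp only [Submodule.coe_add, Pi.add_apply, Prod.fst_add, Prod.snd_add]; ring
      map_smul' := fun c R => by
        rw [RingHom.id_apply, smul_eq_mul, Finset.mul_sum]
        refine Finset.sum_congr rfl fun u _ => ?_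
        simp only [Submodule.coe_smul, Pi.smul_apply, Prod.smul_fst, Prod.smul_snd, smul_eq_mul]
        ring }
  let ℓ : {u // u ∉ I} → E →ₗ[ZMod 2] ZMod 2 := fun u =>
    { toFun := fun R => (R.1 u).2 + oddSum G (fun w => (R.1 w).1) u
      map_add' := fun R S => by
        have : oddSum G (fun w => ((R + S).1 w).1) u =
            oddSum G (fun w => (R.1 w).1) u + oddSum G (fun w => (S.1 w).1) u := by
          simp only [oddSum, ← Finset.sum_add_distrib]
          refine Finset.sum_congr rfl fun w _ => ?_
          split_ifs <;> simp
        rw [this]; simp only [Submodule.coe_add, Pi.add_apply, Prod.snd_add]; ring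
      map_smul' := fun c R => by
        have : oddSum G (fun w => ((c • R).1 w).1) u =
            c * oddSum G (fun w => (R.1 w).1) u := by
          simp only [oddSum, Finset.mul_sum]
          refine Finset.sum_congr rfl fun w _ => ?_
          split_ifs <;> simp
        rw [this]
        simp only [Submodule.coe_smul, Pi.smul_apply, Prod.smul_snd, smul_eq_mul,
          RingHom.id_apply]
        ring }
  have hspan : ev e ∈ Submodule.span (ZMod 2) (Set.range ℓ) := by
    refine mem_span_of_iInf_ker_le_ker fun R hR => ?_
    rw [LinearMap.mem_ker]
    refine h R.1 (fun u => R.2 u (Set.mem_univ u)) fun u hu => ?_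
    have : ℓ ⟨u, hu⟩ R = 0 := by
      have := (Submodule.mem_iInf _).mp hR ⟨u, hu⟩
      simpa using this
    have h2 : (R.1 u).2 + oddSum G (fun w => (R.1 w).1) u = 0 := this
    rw [← add_zero (R.1 u).2, ← ZMod.add_self_two (oddSum G (fun w => (R.1 w).1) u), ← add_assoc,
      h2, zero_add]
  obtain ⟨k, hk⟩ := (Submodule.mem_span_range_iff_exists_fun (ZMod 2)).mp hspan
  let K : W → ZMod 2 := fun u => if hu : u ∈ I then 0 else k ⟨u, hu⟩
  refine ⟨K, fun u hu => by simp [K, hu], fun u r hr => ?_⟩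
  have key : ∀ R : E, ∑ u, ((R.1 u).1 * oddSum G K u + (R.1 u).2 * K u) = ev e R := by
    intro R
    rw [← hk, LinearMap.sum_apply, Finset.sum_add_distrib, oddSum_comm, ← Finset.sum_add_distrib]
    have : ∀ u, oddSum G (fun w => (R.1 w).1) u * K u + (R.1 u).2 * K u =
        if hu : u ∉ I then k ⟨u, hu⟩ * ℓ ⟨u, hu⟩ R else 0 := by
      intro u
      by_cases hu : u ∈ I
      · simp [K, hu]
      · simp only [K, hu, dif_neg, not_false_eq_true, dif_pos]
        change _ = k ⟨u, hu⟩ * ((R.1 u).2 + oddSum G (fun w => (R.1 w).1) u)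
        ring
    rw [Finset.sum_congr rfl fun u _ => this u,
      ← Finset.sum_filter_of_ne (p := fun u => u ∉ I) (fun u _ hu => by
        by_contra hn; exact hu (dif_neg (not_not.mpr hn))),
      Finset.sum_subtype (p := fun u => u ∉ I) _ (by simp)]
    refine Finset.sum_congr rfl fun u _ => ?_
    simp [u.2]
  have hmem : Pi.single u r ∈ E := by
    intro w _
    by_cases hw : w = u
    · subst hw; simpa using hr
    · simp [hw]
  have := key ⟨Pi.single u r, hmem⟩
  change _ = ∑ w, (((Pi.single u r : W → ZMod 2 × ZMod 2) w).1 * (e w).2 +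
    ((Pi.single u r : W → ZMod 2 × ZMod 2) w).2 * (e w).1) at this
  rw [Finset.sum_eq_single u, Finset.sum_eq_single u] at this
  · simpa using this
  · intro w _ hw; simp [hw]
  · simp
  · intro w _ hw; simp [hw]
  · simp

end Duality

/-! ### Runnable patterns -/

namespace XYFusionPattern

section Runnable

variable {V F : Type*} {P : XYFusionPattern V F}

/-- The command acts on the qubit `u` by a `CZ` gate or a fusion. -/
def Touches (P : XYFusionPattern V F) (u : V) : Command V F P.outputs → Prop
  | .entangle i j _ => u = i ∨ u = j
  | .fuse f => u = (P.ends f).1 ∨ u = (P.ends f).2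
  | _ => False

lemma Runnable.measure_notMem (hrun : P.Runnable) {p q : List (Command V F P.outputs)}
    (h : P.commands = p ++ q) {i : {v : V // v ∉ P.outputs}} (hi : Command.measure i ∈ p) :
    Command.measure i ∉ q := by
  intro hq
  obtain ⟨q1, q2, rfl⟩ := List.append_of_mem hq
  have := hrun (p ++ q1) (.measure i) q2 (by simpa using h)
  exact this.2 i.2 (List.mem_append_left _ hi)

lemma Runnable.fuse_notMem (hrun : P.Runnable) {p q : List (Command V F P.outputs)}
    (h : P.commands = p ++ q) {f : F} (hf : Command.fuse f ∈ p) : Command.fuse f ∉ q := by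
  intro hq
  obtain ⟨q1, q2, rfl⟩ := List.append_of_mem hq
  have := hrun (p ++ q1) (.fuse f) q2 (by simpa using h)
  exact this.1 (List.mem_append_left _ hf)

lemma preparedBy_append_left {p : List (Command V F P.outputs)} {u : V} (hu : u ∈ P.preparedBy p)
    (q : List (Command V F P.outputs)) : u ∈ P.preparedBy (p ++ q) :=
  hu.imp_right fun h => List.mem_append_left _ h

lemma Runnable.prepared_of_measure (hrun : P.Runnable) {p q : List (Command V F P.outputs)}
    (h : P.commands = p ++ q) {i : {v : V // v ∉ P.outputs}} (hi : Command.measure i ∈ p) :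
    (i : V) ∈ P.preparedBy p := by
  obtain ⟨p1, p2, rfl⟩ := List.append_of_mem hi
  have := hrun p1 (.measure i) (p2 ++ q) (by simpa using h)
  exact preparedBy_append_left this.1 _

lemma Runnable.live_of_touches (hrun : P.Runnable) {p q : List (Command V F P.outputs)}
    {c : Command V F P.outputs} (h : P.commands = p ++ c :: q) {u : V} (hc : P.Touches u c) :
    u ∈ P.live p := by
  have := hrun p c q h
  cases c with
  | entangle i j hij => rcases hc with rfl | rfl; exacts [this.1, this.2]
  | fuse f => rcases hc with rfl | rfl; exacts [this.2.1, this.2.2]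
  | _ => exact hc.elim

lemma Runnable.prepared_of_touches (hrun : P.Runnable) {p q : List (Command V F P.outputs)}
    (h : P.commands = p ++ q) {c : Command V F P.outputs} (hc : c ∈ p) {u : V}
    (hu : P.Touches u c) : u ∈ P.preparedBy p := by
  obtain ⟨p1, p2, rfl⟩ := List.append_of_mem hc
  exact preparedBy_append_left
    (hrun.live_of_touches (q := p2 ++ q) (by simpa using h) hu).1 _

lemma Runnable.not_touches_of_measure (hrun : P.Runnable) {p q : List (Command V F P.outputs)}
    (h : P.commands = p ++ q) {i : {v : V // v ∉ P.outputs}} (hi : Command.measure i ∈ p)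
    {c : Command V F P.outputs} (hc : c ∈ q) : ¬ P.Touches i c := by
  intro hu
  obtain ⟨q1, q2, rfl⟩ := List.append_of_mem hc
  exact (hrun.live_of_touches (p := p ++ q1) (q := q2) (by simpa using h) hu).2 i.2
    (List.mem_append_left _ hi)

lemma Runnable.mem_live_prepare (hrun : P.Runnable) {p q : List (Command V F P.outputs)} {i : V}
    (h : P.commands = p ++ Command.prepare i :: q) (u : V) :
    u ∈ P.live (p ++ [Command.prepare i]) ↔ u = i ∨ u ∈ P.live p := by
  have hi : i ∉ P.preparedBy p := hrun _ _ _ h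
  constructor
  · rintro ⟨h1, h2⟩
    by_cases hu : u = i
    · exact Or.inl hu
    · refine Or.inr ⟨?_, fun h' hm => h2 h' (List.mem_append_left _ hm)⟩
      rcases h1 with h1 | h1
      · exact Or.inl h1
      · rcases List.mem_append.mp h1 with h1 | h1
        · exact Or.inr h1
        · simp [hu] at h1
  · rintro (rfl | ⟨h1, h2⟩)
    · refine ⟨Or.inr (by simp), fun h' hm => ?_⟩
      rcases List.mem_append.mp hm with hm | hm
      · exact hi (hrun.prepared_of_measure h hm)
      · simp at hm
    · refine ⟨preparedBy_append_left h1 _, fun h' hm => ?_⟩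
      rcases List.mem_append.mp hm with hm | hm
      · exact h2 h' hm
      · simp at hm

lemma mem_live_measure {p : List (Command V F P.outputs)} {i : {v : V // v ∉ P.outputs}} (u : V) :
    u ∈ P.live (p ++ [Command.measure i]) ↔ u ≠ i ∧ u ∈ P.live p := by
  constructor
  · rintro ⟨h1, h2⟩
    refine ⟨?_, ?_, fun h' hm => h2 h' (List.mem_append_left _ hm)⟩
    · rintro rfl; exact h2 i.2 (by simp)
    · rcases h1 with h1 | h1
      · exact Or.inl h1
      · exact Or.inr (by simpa using h1)
  · rintro ⟨h0, h1, h2⟩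
    refine ⟨preparedBy_append_left h1 _, fun h' hm => ?_⟩
    rcases List.mem_append.mp hm with hm | hm
    · exact h2 h' hm
    · simp only [List.mem_singleton, Command.measure.injEq] at hm
      exact h0 (congrArg Subtype.val hm)

lemma live_append_singleton {p : List (Command V F P.outputs)} {c : Command V F P.outputs}
    (h1 : ∀ i, c ≠ .prepare i) (h2 : ∀ i, c ≠ .measure i) : P.live (p ++ [c]) = P.live p := by
  have e1 : ∀ i, Command.prepare i ∈ p ++ [c] ↔ Command.prepare i ∈ p := fun i => by
    simp [(h1 i).symm]
  have e2 : ∀ i, Command.measure i ∈ p ++ [c] ↔ Command.measure i ∈ p := fun i => by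
    simp [(h2 i).symm]
  simp only [live, preparedBy, e1, e2]

lemma live_nil : P.live [] = {i | i ∈ P.inputs} := by
  ext u; simp [live, preparedBy]

lemma mem_outputs_of_mem_live {u : V} (hu : u ∈ P.live P.commands) : u ∈ P.outputs := by
  by_contra h
  exact hu.2 h (P.measured ⟨u, h⟩)

end Runnable

end XYFusionPattern

/-! ### Execution of command sequences -/

namespace XYFusionPattern

section Run

variable {V F : Type*} [DecidableEq V] (P : XYFusionPattern V F)

/-- The Kraus map of a command for the measurement angles `β`. -/
noncomputable def act (β : {v : V // v ∉ P.outputs} → MeasAngle)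
    (m : {v : V // v ∉ P.outputs} → ZMod 2) (k : F → ZMod 2) (c : Command V F P.outputs) :
    RegState V →ₗ[ℂ] RegState V :=
  (P.withAngles β).kraus m k c

/-- The composition of the Kraus maps of a sequence of commands for the measurement angles `β`. -/
noncomputable def run (β : {v : V // v ∉ P.outputs} → MeasAngle)
    (m : {v : V // v ∉ P.outputs} → ZMod 2) (k : F → ZMod 2) :
    List (Command V F P.outputs) → (RegState V →ₗ[ℂ] RegState V)
  | [] => LinearMap.id
  | c :: l => run β m k l ∘ₗ P.act β m k c

variable {P}
variable {β β' : {v : V // v ∉ P.outputs} → MeasAngle}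
  {m m' : {v : V // v ∉ P.outputs} → ZMod 2} {k k' : F → ZMod 2}

@[simp] lemma run_nil (ψ : RegState V) : P.run β m k [] ψ = ψ := rfl

@[simp] lemma run_cons (c : Command V F P.outputs) (l : List (Command V F P.outputs))
    (ψ : RegState V) : P.run β m k (c :: l) ψ = P.run β m k l (P.act β m k c ψ) := rfl

lemma run_append (l l' : List (Command V F P.outputs)) (ψ : RegState V) :
    P.run β m k (l ++ l') ψ = P.run β m k l' (P.run β m k l ψ) := by
  induction l generalizing ψ with
  | nil => rfl
  | cons c l ih => simp [ih]

lemma branch_apply (l : List (Command V F P.outputs)) (x : ({i : V // i ∈ P.inputs} → ZMod 2) → ℂ) :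
    (P.withAngles β).branch l m k x = P.run β m k l (P.embed x) := by
  suffices H : ∀ A : (({i : V // i ∈ P.inputs} → ZMod 2) → ℂ) →ₗ[ℂ] RegState V,
      l.foldl (fun A c => (P.withAngles β).kraus m k c ∘ₗ A) A x = P.run β m k l (A x) from
    H (P.embed)
  induction l with
  | nil => intro A; rfl
  | cons c l ih => intro A; exact ih _

/-! ### Pauli operators passing through a command sequence -/

/-- The change of the exponents of `Z` when the Pauli operator with exponents `A` of `X` (on qubits
and fusion qubits) passes a command. -/
def kick (P : XYFusionPattern V F) (A : V ⊕ F → ZMod 2) : Command V F P.outputs → V → ZMod 2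
  | .entangle i j _ => Pi.single i (A (.inl j)) + Pi.single j (A (.inl i))
  | .fuse f => Pi.single ((P.ends f).1 : V) (A (.inr f)) +
      Pi.single ((P.ends f).2 : V) (A (.inr f))
  | _ => 0

lemma kick_eq_zero {A : V ⊕ F → ZMod 2} {c : Command V F P.outputs} {u : V}
    (h : ¬ P.Touches u c) : P.kick A c u = 0 := by
  cases c with
  | entangle i j hij =>
    obtain ⟨h1, h2⟩ := not_or.mp h
    simp [kick, h1, h2]
  | fuse f =>
    obtain ⟨h1, h2⟩ := not_or.mp h
    simp [kick, h1, h2]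
  | _ => rfl

lemma sum_kick_eq_zero {A : V ⊕ F → ZMod 2} {l : List (Command V F P.outputs)} {u : V}
    (h : ∀ c ∈ l, ¬ P.Touches u c) : (l.map (P.kick A)).sum u = 0 := by
  induction l with
  | nil => rfl
  | cons c l ih =>
    rw [List.map_cons, List.sum_cons, Pi.add_apply, kick_eq_zero (h c (by simp)),
      ih fun d hd => h d (by simp [hd]), add_zero]

/-- The exponents of `X`, on the available qubits, of a Pauli operator passing through the pattern
after the commands `p`. -/
noncomputable def webX (P : XYFusionPattern V F) (A : V ⊕ F → ZMod 2)
    (p : List (Command V F P.outputs)) : V → ZMod 2 :=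
  (P.live p).indicator fun u => A (.inl u)

/-- The exponents of `Z`, on the available qubits, of a Pauli operator passing through the pattern
after the commands `p`; it starts with the exponents `J`. -/
noncomputable def webZ (P : XYFusionPattern V F) (A : V ⊕ F → ZMod 2) (J : V → ZMod 2)
    (p : List (Command V F P.outputs)) : V → ZMod 2 :=
  (P.live p).indicator (J + (p.map (P.kick A)).sum)

omit [DecidableEq V] in
lemma webX_of_mem {A : V ⊕ F → ZMod 2} {p : List (Command V F P.outputs)} {u : V}
    (h : u ∈ P.live p) : P.webX A p u = A (.inl u) :=
  Set.indicator_of_mem h _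

omit [DecidableEq V] in
lemma webX_of_notMem {A : V ⊕ F → ZMod 2} {p : List (Command V F P.outputs)} {u : V}
    (h : u ∉ P.live p) : P.webX A p u = 0 :=
  Set.indicator_of_notMem h _

lemma webZ_of_mem {A : V ⊕ F → ZMod 2} {J : V → ZMod 2} {p : List (Command V F P.outputs)} {u : V}
    (h : u ∈ P.live p) : P.webZ A J p u = J u + (p.map (P.kick A)).sum u :=
  Set.indicator_of_mem h _

lemma webZ_of_notMem {A : V ⊕ F → ZMod 2} {J : V → ZMod 2} {p : List (Command V F P.outputs)}
    {u : V} (h : u ∉ P.live p) : P.webZ A J p u = 0 :=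
  Set.indicator_of_notMem h _

omit [DecidableEq V] in
lemma webX_append_of_live {A : V ⊕ F → ZMod 2} {p : List (Command V F P.outputs)}
    {c : Command V F P.outputs} (h : P.live (p ++ [c]) = P.live p) :
    P.webX A (p ++ [c]) = P.webX A p := by
  rw [webX, h, webX]

lemma sum_kick_append_singleton {A : V ⊕ F → ZMod 2} (p : List (Command V F P.outputs))
    (c : Command V F P.outputs) (u : V) :
    ((p ++ [c]).map (P.kick A)).sum u = (p.map (P.kick A)).sum u + P.kick A c u := by
  simp

lemma webZ_append_of_live {A : V ⊕ F → ZMod 2} {J : V → ZMod 2}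
    {p : List (Command V F P.outputs)} {c : Command V F P.outputs}
    (h : P.live (p ++ [c]) = P.live p) (hc : ∀ u, P.kick A c u ≠ 0 → u ∈ P.live p) :
    P.webZ A J (p ++ [c]) = P.webZ A J p + P.kick A c := by
  funext u
  rw [Pi.add_apply]
  by_cases hu : u ∈ P.live p
  · rw [webZ_of_mem hu, webZ_of_mem (h ▸ hu), sum_kick_append_singleton, add_assoc]
  · have : P.kick A c u = 0 := by by_contra h'; exact hu (hc u h')
    rw [webZ_of_notMem hu, webZ_of_notMem (h ▸ hu), this, add_zero]

variable [Fintype V] {A : V ⊕ F → ZMod 2} {J : V → ZMod 2}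

lemma exists_act_measure_web (hrun : P.Runnable) {p q : List (Command V F P.outputs)}
    {i : {v : V // v ∉ P.outputs}} (h : P.commands = p ++ Command.measure i :: q)
    {t : ZMod 2} {ρ : ℂ}
    (hβ : ∀ s, BraShift (ket (P.label i) (β i) s) (A (.inl i))
      (J i + (P.commands.map (P.kick A)).sum i) (sgn (s * t) * ρ)
      (ket (P.label i) (β' i) s)) (ψ : RegState V) :
    P.act β m k (.measure i) (pauliFrame (P.webX A p) (P.webZ A J p) ψ) =
      (sgn (m i * t) * ρ) • pauliFrame (P.webX A (p ++ [.measure i]))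
        (P.webZ A J (p ++ [.measure i])) (P.act β' m k (.measure i) ψ) := by
  have hlive : (i : V) ∈ P.live p := hrun _ _ _ h
  have hsum : (P.commands.map (P.kick A)).sum i = (p.map (P.kick A)).sum i := by
    have : ((Command.measure i :: q).map (P.kick A)).sum (i : V) = 0 := by
      rw [List.map_cons, List.sum_cons, Pi.add_apply, sum_kick_eq_zero fun c hc =>
        hrun.not_touches_of_measure (p := p ++ [.measure i]) (by simpa using h) (by simp) hc]
      simp [kick]
    rw [h, List.map_append, List.sum_append, Pi.add_apply, this, add_zero]
  have hX : P.webX A (p ++ [.measure i]) = Function.update (P.webX A p) i 0 := by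
    funext u
    by_cases hu : u = i
    · rw [hu, Function.update_self, webX_of_notMem (by simp [mem_live_measure])]
    · rw [Function.update_of_ne hu]
      by_cases hl : u ∈ P.live p
      · rw [webX_of_mem hl, webX_of_mem (mem_live_measure u |>.mpr ⟨hu, hl⟩)]
      · rw [webX_of_notMem hl, webX_of_notMem fun h' => hl (mem_live_measure u |>.mp h').2]
  have hZ : P.webZ A J (p ++ [.measure i]) = Function.update (P.webZ A J p) i 0 := by
    funext u
    by_cases hu : u = i
    · rw [hu, Function.update_self, webZ_of_notMem (by simp [mem_live_measure])]
    · rw [Function.update_of_ne hu]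
      by_cases hl : u ∈ P.live p
      · rw [webZ_of_mem hl, webZ_of_mem (mem_live_measure u |>.mpr ⟨hu, hl⟩),
          sum_kick_append_singleton]
        simp [kick]
      · rw [webZ_of_notMem hl, webZ_of_notMem fun h' => hl (mem_live_measure u |>.mp h').2]
  rw [hX, hZ]
  refine Gate.project_pauliFrame ?_ ψ
  rw [webX_of_mem hlive, webZ_of_mem hlive, ← hsum]
  exact hβ (m i)

lemma exists_act_fuse_web (hrun : P.Runnable) {p q : List (Command V F P.outputs)} {f : F}
    (h : P.commands = p ++ Command.fuse f :: q)
    (hA : (A (.inr f), A (.inl (P.ends f).1) + A (.inl (P.ends f).2)) ∈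
      (P.fusionLabel f).toMeasLabel.compatible) :
    ∃ ρ : ℂ, ρ ≠ 0 ∧ ∀ (m : {v : V // v ∉ P.outputs} → ZMod 2) (k : F → ZMod 2) (ψ : RegState V),
      P.act β m k (.fuse f) (pauliFrame (P.webX A p) (P.webZ A J p) ψ) =
      (sgn (k f * (P.fusionLabel f).toMeasLabel.pairing
        (A (.inr f), A (.inl (P.ends f).1) + A (.inl (P.ends f).2))) * ρ) •
        pauliFrame (P.webX A (p ++ [.fuse f])) (P.webZ A J (p ++ [.fuse f]))
          (P.act β' m k (.fuse f) ψ) := by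
  obtain ⟨-, h1, h2⟩ : P.Allowed p (.fuse f) := hrun _ _ _ h
  have hl : P.live (p ++ [.fuse f]) = P.live p :=
    live_append_singleton (fun _ => by simp) fun _ => by simp
  have hX : P.webX A (p ++ [.fuse f]) = P.webX A p :=
    webX_append_of_live hl
  have hZ : P.webZ A J (p ++ [.fuse f]) = P.webZ A J p + P.kick A (.fuse f) := by
    refine webZ_append_of_live hl fun u hu => ?_
    by_contra hn
    refine hu (kick_eq_zero ?_)
    rintro (rfl | rfl) <;> exact hn ‹_›
  have e : P.webX A p (P.ends f).1 + P.webX A p (P.ends f).2 =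
      A (.inl (P.ends f).1) + A (.inl (P.ends f).2) := by
    rw [webX_of_mem h1, webX_of_mem h2]
  obtain ⟨ρ, hρ, H⟩ := Gate.exists_fuse_pauliFrame ((P.ends f).1 : V) ((P.ends f).2 : V)
    (P.fusionLabel f) (P.webX A p) (P.webZ A J p) (A (.inr f)) (by rw [e]; exact hA)
  refine ⟨ρ, hρ, fun m k ψ => ?_⟩
  rw [hX, hZ, ← e]
  exact H (k f) ψ

/-- Hypotheses under which a Pauli operator passes through the whole pattern: it acts by `Z` only
on inputs at the start, and at each measurement and fusion it is compatible with the label,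
changing the angles `β` to `β'`. -/
structure IsWeb (P : XYFusionPattern V F) (A : V ⊕ F → ZMod 2) (J : V → ZMod 2)
    (β β' : {v : V // v ∉ P.outputs} → MeasAngle) : Prop where
  zero_of_notMem : ∀ u ∉ P.inputs, J u = 0
  fuse : ∀ f, (A (.inr f), A (.inl (P.ends f).1) + A (.inl (P.ends f).2)) ∈
    (P.fusionLabel f).toMeasLabel.compatible
  measure : ∀ i : {v : V // v ∉ P.outputs}, ∃ ρ : ℂ, ρ ≠ 0 ∧ ∀ s,
    BraShift (ket (P.label i) (β i) s) (A (.inl i)) (J i + (P.commands.map (P.kick A)).sum i)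
      (sgn (s * (P.label i).pairing (A (.inl i), J i + (P.commands.map (P.kick A)).sum i)) * ρ)
      (ket (P.label i) (β' i) s)

lemma IsWeb.exists_act (hrun : P.Runnable) (hweb : P.IsWeb A J β β')
    {p q : List (Command V F P.outputs)} {c : Command V F P.outputs}
    (h : P.commands = p ++ c :: q) :
    ∃ ρ : ℂ, ρ ≠ 0 ∧ ∀ ψ, P.act β m k c (pauliFrame (P.webX A p) (P.webZ A J p) ψ) =
      ρ • pauliFrame (P.webX A (p ++ [c])) (P.webZ A J (p ++ [c])) (P.act β' m k c ψ) := by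
  have hallowed := hrun _ _ _ h
  cases c with
  | prepare i =>
    have hi : i ∉ P.preparedBy p := hallowed
    have hl : i ∉ P.live p := fun h' => hi h'.1
    have hX : P.webX A (p ++ [.prepare i]) = Function.update (P.webX A p) i (A (.inl i)) := by
      funext u
      by_cases hu : u = i
      · subst hu
        rw [Function.update_self, webX_of_mem ((hrun.mem_live_prepare h u).mpr (.inl rfl))]
      · rw [Function.update_of_ne hu]
        by_cases hl : u ∈ P.live p
        · rw [webX_of_mem hl, webX_of_mem ((hrun.mem_live_prepare h u).mpr (.inr hl))]
        · rw [webX_of_notMem hl, webX_of_notMem fun h' =>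
            ((hrun.mem_live_prepare h u).mp h').elim hu hl]
    have hZ : P.webZ A J (p ++ [.prepare i]) = Function.update (P.webZ A J p) i 0 := by
      funext u
      by_cases hu : u = i
      · subst hu
        have h0 : (p.map (P.kick A)).sum u = 0 :=
          sum_kick_eq_zero fun c hc ht => hi (hrun.prepared_of_touches h hc ht)
        rw [Function.update_self, webZ_of_mem ((hrun.mem_live_prepare h u).mpr (.inl rfl)),
          sum_kick_append_singleton, h0, hweb.zero_of_notMem u fun h' => hi (Or.inl h')]
        simp [kick]
      · rw [Function.update_of_ne hu]
        by_cases hl : u ∈ P.live p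
        · rw [webZ_of_mem hl, webZ_of_mem ((hrun.mem_live_prepare h u).mpr (.inr hl)),
            sum_kick_append_singleton]
          simp [kick]
        · rw [webZ_of_notMem hl, webZ_of_notMem fun h' =>
            ((hrun.mem_live_prepare h u).mp h').elim hu hl]
    refine ⟨1, one_ne_zero, fun ψ => ?_⟩
    rw [hX, hZ, one_smul]
    exact Gate.prepare_pauliFrame i _ _ _ (webX_of_notMem hl) ψ
  | entangle i j hij =>
    have hl : P.live (p ++ [.entangle i j hij]) = P.live p :=
      live_append_singleton (fun _ => by simp) fun _ => by simp
    have hZ : P.webZ A J (p ++ [.entangle i j hij]) =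
        P.webZ A J p + P.kick A (.entangle i j hij) := by
      refine webZ_append_of_live hl fun u hu => ?_
      by_contra hn
      refine hu (kick_eq_zero ?_)
      rintro (rfl | rfl)
      exacts [hn hallowed.1, hn hallowed.2]
    refine ⟨_, sgn_ne_zero (P.webX A p i * P.webX A p j), fun ψ => ?_⟩
    rw [webX_append_of_live hl, hZ]
    have := Gate.cz_pauliFrame i j (P.webX A p) (P.webZ A J p) ψ
    rw [webX_of_mem hallowed.1, webX_of_mem hallowed.2] at this ⊢
    exact this
  | fuse f =>
    obtain ⟨ρ, hρ, H⟩ := exists_act_fuse_web (β := β) (β' := β') (J := J) hrun h (hweb.fuse f)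
    exact ⟨_, mul_ne_zero (sgn_ne_zero _) hρ, H m k⟩
  | measure i =>
    obtain ⟨ρ, hρ, H⟩ := hweb.measure i
    exact ⟨_, mul_ne_zero (sgn_ne_zero _) hρ, exists_act_measure_web hrun h H⟩
  | corrX i s =>
    have hl : P.live (p ++ [.corrX i s]) = P.live p :=
      live_append_singleton (fun _ => by simp) fun _ => by simp
    rw [webX_append_of_live hl, webZ_append_of_live hl fun u hu => absurd rfl hu,
      show P.kick A (.corrX i s) = 0 from rfl, add_zero]
    exact ⟨_, sgn_ne_zero _, fun ψ => Gate.pauliX_pauliFrame i _ _ _ ψ⟩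
  | corrZ i s =>
    have hl : P.live (p ++ [.corrZ i s]) = P.live p :=
      live_append_singleton (fun _ => by simp) fun _ => by simp
    rw [webX_append_of_live hl, webZ_append_of_live hl fun u hu => absurd rfl hu,
      show P.kick A (.corrZ i s) = 0 from rfl, add_zero]
    exact ⟨_, sgn_ne_zero _, fun ψ => Gate.pauliZ_pauliFrame i _ _ _ ψ⟩

lemma IsWeb.exists_run (hrun : P.Runnable) (hweb : P.IsWeb A J β β')
    (l p q : List (Command V F P.outputs)) (h : P.commands = p ++ (l ++ q)) :
    ∃ ρ : ℂ, ρ ≠ 0 ∧ ∀ ψ, P.run β m k l (pauliFrame (P.webX A p) (P.webZ A J p) ψ) =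
      ρ • pauliFrame (P.webX A (p ++ l)) (P.webZ A J (p ++ l)) (P.run β' m k l ψ) := by
  induction l generalizing p with
  | nil => exact ⟨1, one_ne_zero, fun ψ => by simp⟩
  | cons c l ih =>
    obtain ⟨ρ, hρ, H⟩ := hweb.exists_act (m := m) (k := k) hrun h
    obtain ⟨ρ', hρ', H'⟩ := ih (p ++ [c]) (by simpa using h)
    refine ⟨ρ * ρ', mul_ne_zero hρ hρ', fun ψ => ?_⟩
    rw [run_cons, run_cons, H, map_smul, H', smul_smul, List.append_assoc, List.singleton_append]

end Run

end XYFusionPattern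

namespace XYFusionPattern

section Adaptive

variable {V F : Type*} [DecidableEq V] {P : XYFusionPattern V F}
variable {β β' : {v : V // v ∉ P.outputs} → MeasAngle}
  {m m' : {v : V // v ∉ P.outputs} → ZMod 2} {k k' : F → ZMod 2}

/-! ### Adapting later outcomes -/

lemma _root_.Signal.eval_congr {Q F : Type*} {s : Signal Q F} {m m' : Q → ZMod 2}
    {k k' : F → ZMod 2} (hm : ∀ i ∈ s.meas, m i = m' i) (hk : ∀ f ∈ s.fus, k f = k' f) :
    s.eval m k = s.eval m' k' := by
  rw [Signal.eval, Signal.eval, Finset.sum_congr rfl hm, Finset.sum_congr rfl hk]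

/-- Suppose that the remaining measurements have angle `0`. A Pauli operator acting
before the remaining commands, and a change of the outcomes obtained so far (which affects later
corrections), can then be compensated by changing the remaining outcomes, up to a Pauli operator at
the end. -/
lemma exists_run_pauliFrame [Fintype V] (hrun : P.Runnable) (q p : List (Command V F P.outputs))
    (h : P.commands = p ++ q) (a b : V → ZMod 2) (ha : ∀ u ∉ P.live p, a u = 0)
    (m m' : {v : V // v ∉ P.outputs} → ZMod 2) (k k' : F → ZMod 2) :
    ∃ (m'' : {v : V // v ∉ P.outputs} → ZMod 2) (k'' : F → ZMod 2) (a' b' : V → ZMod 2) (ρ : ℂ),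
      (∀ i, Command.measure i ∉ q → m'' i = m' i) ∧ (∀ f, Command.fuse f ∉ q → k'' f = k' f) ∧
      ‖ρ‖ = 1 ∧ ∀ β : {v : V // v ∉ P.outputs} → MeasAngle,
        (∀ i, Command.measure i ∈ q → β i = MeasAngle.zero) → ∀ ψ,
          P.run β m'' k'' q (pauliFrame a b ψ) = ρ • pauliFrame a' b' (P.run β m k q ψ) := by
  classical
  induction q generalizing p a b m' k' with
  | nil => exact ⟨m', k', a, b, 1, fun _ _ => rfl, fun _ _ => rfl, by simp, fun β _ ψ => by simp⟩
  | cons c q ih =>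
    have h' : P.commands = (p ++ [c]) ++ q := by simpa using h
    have hallowed := hrun _ _ _ h
    -- it suffices to treat the command `c`, possibly fixing its own outcome
    suffices H : ∃ (m₁ : {v : V // v ∉ P.outputs} → ZMod 2) (k₁ : F → ZMod 2) (a₁ b₁ : V → ZMod 2)
        (ρ₁ : ℂ), (∀ i, Command.measure i ≠ c → m₁ i = m' i) ∧
        (∀ f, Command.fuse f ≠ c → k₁ f = k' f) ∧ ‖ρ₁‖ = 1 ∧
        (∀ u ∉ P.live (p ++ [c]), a₁ u = 0) ∧
        ∀ (m₂ : {v : V // v ∉ P.outputs} → ZMod 2) (k₂ : F → ZMod 2),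
          (∀ i, Command.measure i ∉ q → m₂ i = m₁ i) →
          (∀ f, Command.fuse f ∉ q → k₂ f = k₁ f) →
          ∀ β : {v : V // v ∉ P.outputs} → MeasAngle,
            (∀ i, Command.measure i ∈ c :: q → β i = MeasAngle.zero) → ∀ ψ,
              P.act β m₂ k₂ c (pauliFrame a b ψ) = ρ₁ • pauliFrame a₁ b₁ (P.act β m k c ψ) by
      obtain ⟨m₁, k₁, a₁, b₁, ρ₁, hm₁, hk₁, hρ₁, ha₁, H⟩ := H
      obtain ⟨m₂, k₂, a₂, b₂, ρ₂, hm₂, hk₂, hρ₂, H₂⟩ := ih (p ++ [c]) h' a₁ b₁ ha₁ m₁ k₁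
      refine ⟨m₂, k₂, a₂, b₂, ρ₁ * ρ₂, fun i hi => ?_, fun f hf => ?_, by simp [hρ₁, hρ₂],
        fun β hβ ψ => ?_⟩
      · rw [List.mem_cons, not_or] at hi
        rw [hm₂ i hi.2, hm₁ i hi.1]
      · rw [List.mem_cons, not_or] at hf
        rw [hk₂ f hf.2, hk₁ f hf.1]
      · rw [run_cons, run_cons, H m₂ k₂ hm₂ hk₂ β hβ, map_smul,
          H₂ β (fun i hi => hβ i (List.mem_cons_of_mem _ hi)), smul_smul]
    have avail : ∀ s : Signal {v : V // v ∉ P.outputs} F, P.Available p s →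
        ∀ (m₂ : {v : V // v ∉ P.outputs} → ZMod 2) (k₂ : F → ZMod 2),
          (∀ i, Command.measure i ∉ q → m₂ i = m' i) →
          (∀ f, Command.fuse f ∉ q → k₂ f = k' f) → s.eval m₂ k₂ = s.eval m' k' := by
      intro s hs m₂ k₂ hm₂ hk₂
      refine Signal.eval_congr (fun i hi => hm₂ i ?_) (fun f hf => hk₂ f ?_)
      · exact hrun.measure_notMem h' (List.mem_append_left _ (hs.1 i hi))
      · exact hrun.fuse_notMem h' (List.mem_append_left _ (hs.2.1 f hf))
    cases c with
    | prepare i =>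
      have hi : i ∉ P.live p := fun h' => hallowed h'.1
      refine ⟨m', k', Function.update a i 0, Function.update b i 0, 1, fun _ _ => rfl,
        fun _ _ => rfl, by simp, fun u hu => ?_, fun m₂ k₂ _ _ β _ ψ => ?_⟩
      · rw [hrun.mem_live_prepare h, not_or] at hu
        rw [Function.update_of_ne hu.1, ha u hu.2]
      · rw [one_smul]
        exact Gate.prepare_pauliFrame i 0 a b (ha i hi) ψ
    | entangle i j hij =>
      refine ⟨m', k', a, _, sgn (a i * a j), fun _ _ => rfl, fun _ _ => rfl, by simp, ?_,
        fun m₂ k₂ _ _ β _ ψ => Gate.cz_pauliFrame i j a b ψ⟩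
      rwa [live_append_singleton (fun _ => by simp) fun _ => by simp]
    | fuse f =>
      refine ⟨m', Function.update k' f (k f + (a (P.ends f).1 + a (P.ends f).2)), a, b, 1,
        fun _ _ => rfl, fun g hg => ?_, by simp, ?_, fun m₂ k₂ _ hk₂ β _ ψ => ?_⟩
      · exact Function.update_of_ne (fun e => hg (by rw [e])) _ _
      · rwa [live_append_singleton (fun _ => by simp) fun _ => by simp]
      · have e := hk₂ f (hrun.fuse_notMem h' (by simp))
        rw [Function.update_self] at e
        rw [one_smul]
        change Gate.fuse _ _ _ (k₂ f) _ = _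
        rw [e]
        exact Gate.fuse_outcome_pauliFrame _ _ _ _ a b ψ
    | measure i =>
      obtain ⟨s, ρ, hρ, H⟩ := exists_braShift_ket_zero (P.label i) (a i) (b i) (m i)
      refine ⟨Function.update m' i s, k', Function.update a i 0, Function.update b i 0, ρ,
        fun j hj => ?_, fun _ _ => rfl, hρ, fun u hu => ?_, fun m₂ k₂ hm₂ _ β hβ ψ => ?_⟩
      · exact Function.update_of_ne (fun e => hj (by rw [e])) _ _
      · rw [mem_live_measure, not_and] at hu
        by_cases hui : u = i
        · rw [hui, Function.update_self]
        · rw [Function.update_of_ne hui, ha u (hu hui)]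
      · have e := hm₂ i (hrun.measure_notMem h' (by simp))
        rw [Function.update_self] at e
        change Gate.project _ (ket _ _ (m₂ i)) _ = _
        rw [e]
        exact Gate.project_pauliFrame (H (β i) fun _ => hβ i (by simp)) ψ
    | corrX i s =>
      have hl : P.live (p ++ [.corrX i s]) = P.live p :=
        live_append_singleton (fun _ => by simp) fun _ => by simp
      refine ⟨m', k', a + Pi.single i (s.eval m k + s.eval m' k'), b,
        sgn (b i * (s.eval m k + (s.eval m k + s.eval m' k'))), fun _ _ => rfl,
        fun _ _ => rfl, by simp, fun u hu => ?_, fun m₂ k₂ hm₂ hk₂ β _ ψ => ?_⟩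
      · rw [hl] at hu
        have : u ≠ i := fun e => hu (e ▸ hallowed.1)
        simp [ha u hu, this]
      · have e : s.eval m₂ k₂ = s.eval m k + (s.eval m k + s.eval m' k') := by
          rw [avail s hallowed.2 m₂ k₂ hm₂ hk₂, ← add_assoc, ZMod.add_self_two, zero_add]
        change Gate.pauliX i (s.eval m₂ k₂) _ = _
        rw [e, Gate.pauliX_add_pauliFrame]
        rfl
    | corrZ i s =>
      have hl : P.live (p ++ [.corrZ i s]) = P.live p :=
        live_append_singleton (fun _ => by simp) fun _ => by simp
      refine ⟨m', k', a, b + Pi.single i (s.eval m k + s.eval m' k'),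
        sgn (s.eval m k * a i), fun _ _ => rfl, fun _ _ => rfl, by simp, by rwa [hl],
        fun m₂ k₂ hm₂ hk₂ β _ ψ => ?_⟩
      have e : s.eval m₂ k₂ = s.eval m k + (s.eval m k + s.eval m' k') := by
        rw [avail s hallowed.2 m₂ k₂ hm₂ hk₂, ← add_assoc, ZMod.add_self_two, zero_add]
      change Gate.pauliZ i (s.eval m₂ k₂) _ = _
      rw [e, Gate.pauliZ_add_pauliFrame]
      rfl

/-! ### Success branches do not vanish -/

lemma run_congr (hrun : P.Runnable) (l p q : List (Command V F P.outputs))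
    (h : P.commands = p ++ (l ++ q)) (hm : ∀ i, Command.measure i ∈ p ++ l → m i = m' i)
    (hk : ∀ f, Command.fuse f ∈ p ++ l → k f = k' f) (ψ : RegState V) :
    P.run β m k l ψ = P.run β m' k' l ψ := by
  induction l generalizing p ψ with
  | nil => rfl
  | cons c l ih =>
    have hallowed := hrun _ _ _ h
    have e : P.act β m k c = P.act β m' k' c := by
      have eval_eq : ∀ s : Signal {v : V // v ∉ P.outputs} F, P.Available p s →
          s.eval m k = s.eval m' k' := fun s hs =>
        Signal.eval_congr (fun i hi => hm i (List.mem_append_left _ (hs.1 i hi)))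
          (fun f hf => hk f (List.mem_append_left _ (hs.2.1 f hf)))
      cases c with
      | prepare i => rfl
      | entangle i j hij => rfl
      | fuse f =>
        change Gate.fuse _ _ _ (k f) = Gate.fuse _ _ _ (k' f)
        rw [hk f (by simp)]
      | measure i =>
        change Gate.project _ (ket _ _ (m i)) = Gate.project _ (ket _ _ (m' i))
        rw [hm i (by simp)]
      | corrX i s =>
        change Gate.pauliX _ (s.eval m k) = Gate.pauliX _ (s.eval m' k')
        rw [eval_eq s hallowed.2]
      | corrZ i s =>
        change Gate.pauliZ _ (s.eval m k) = Gate.pauliZ _ (s.eval m' k')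
        rw [eval_eq s hallowed.2]
    rw [run_cons, run_cons, e]
    exact ih (p ++ [c]) (by simpa using h) (fun i hi => hm i (by simpa using hi))
      (fun f hf => hk f (by simpa using hf)) _

/-- Qubits that are not yet prepared are in the reference state. -/
lemma run_apply_eq_zero (hrun : P.Runnable) {ψ : RegState V}
    (hψ : ∀ y, (∃ u ∉ P.inputs, y u ≠ 0) → ψ y = 0) (p q : List (Command V F P.outputs))
    (h : P.commands = p ++ q) {u : V} (hu : u ∉ P.preparedBy p) {y : V → ZMod 2} (hy : y u ≠ 0) :
    P.run β m k p ψ y = 0 := by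
  induction p using List.reverseRecOn generalizing q y with
  | nil => exact hψ y ⟨u, fun h' => hu (Or.inl h'), hy⟩
  | append_singleton p c ih =>
    have h' : P.commands = p ++ (c :: q) := by simpa using h
    have hallowed := hrun _ _ _ h'
    have hup : u ∉ P.preparedBy p := fun h' => hu (preparedBy_append_left h' _)
    rw [run_append, run_cons, run_nil]
    have upd : ∀ (i : V) (t : ZMod 2), i ≠ u →
        P.run β m k p ψ (Function.update y i t) = 0 := fun i t hi =>
      ih _ h' hup (by rwa [Function.update_of_ne hi.symm])
    have ne_of_live : ∀ i ∈ P.live p, i ≠ u := fun i hi e => hup (e ▸ hi.1)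
    cases c with
    | prepare i =>
      have hi : i ≠ u := by rintro rfl; exact hu (Or.inr (by simp))
      change ketX 0 (y i) * P.run β m k p ψ (Function.update y i 0) = 0
      rw [upd i 0 hi, mul_zero]
    | entangle i j hij =>
      change Gate.diag _ _ _ = _
      rw [Gate.diag_apply, ih _ h' hup hy, mul_zero]
    | fuse f =>
      change Gate.diag _ _ _ = _
      rw [Gate.diag_apply, ih _ h' hup hy, mul_zero]
    | measure i =>
      change Gate.project _ _ _ _ = _
      rw [Gate.project_apply, Finset.sum_eq_zero fun c _ => by
        rw [upd i c (ne_of_live i hallowed), mul_zero], mul_zero]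
    | corrX i s => exact upd i _ (ne_of_live i hallowed.1)
    | corrZ i s =>
      change Gate.diag _ _ _ = _
      rw [Gate.diag_apply, ih _ h' hup hy, mul_zero]

lemma _root_.superpose_separating {u w v : ZMod 2 → ℂ} {α : ℝ}
    (h : ∀ s, ∑ c, starRingEnd ℂ (superpose u w α s c) * v c = 0) :
    ∑ c, starRingEnd ℂ (u c) * v c = 0 ∧ ∑ c, starRingEnd ℂ (w c) * v c = 0 := by
  have hs0 : ((Real.sqrt 2 : ℝ) : ℂ) ≠ 0 := by simp
  have hz := Complex.exp_ne_zero (α * Complex.I)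
  have expand : ∀ s, ∑ c, starRingEnd ℂ (u c) * v c +
      sgn s * (starRingEnd ℂ) (Complex.exp (α * Complex.I)) *
        ∑ c, starRingEnd ℂ (w c) * v c = 0 := by
    intro s
    rw [← mul_zero ((Real.sqrt 2 : ℝ) : ℂ), ← h s, Finset.mul_sum, Finset.mul_sum,
      ← Finset.sum_add_distrib]
    refine Finset.sum_congr rfl fun c _ => ?_
    simp only [superpose, map_div₀, map_add, map_mul, conj_sgn, Complex.conj_ofReal]
    field_simp
  have h0 := expand 0
  have h1 := expand 1
  simp only [sgn_zero, sgn_one, one_mul, neg_mul] at h0 h1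
  constructor
  · linear_combination (1 / 2) * h0 + (1 / 2) * h1
  · have : (starRingEnd ℂ) (Complex.exp (α * Complex.I)) *
        ∑ c, starRingEnd ℂ (w c) * v c = 0 := by
      linear_combination (1 / 2) * h0 - (1 / 2) * h1
    exact (mul_eq_zero.mp this).resolve_left (by simp)

lemma _root_.ket_separating {l : MeasLabel} {α : ℝ} {v : ZMod 2 → ℂ}
    (h : ∀ s, ∑ c, starRingEnd ℂ (ket l α s c) * v c = 0) (c : ZMod 2) : v c = 0 := by
  have hZ : (∀ s, ∑ c, starRingEnd ℂ (ketZ s c) * v c = 0) → v c = 0 := fun h => by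
    simpa [ketZ] using h c
  have two : ∀ {U : ZMod 2 → ZMod 2 → ℂ}, (∑ c, starRingEnd ℂ (U 0 c) * v c = 0 ∧
      ∑ c, starRingEnd ℂ (U 1 c) * v c = 0) → ∀ s, ∑ c, starRingEnd ℂ (U s c) * v c = 0 := by
    intro U hU s
    rcases zmod_two_cases s with rfl | rfl
    exacts [hU.1, hU.2]
  have hX : (∀ s, ∑ c, starRingEnd ℂ (ketX s c) * v c = 0) → v c = 0 := fun h =>
    hZ (two (superpose_separating h))
  have hY : (∀ s, ∑ c, starRingEnd ℂ (ketY s c) * v c = 0) → v c = 0 := fun h =>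
    hZ (two (superpose_separating h))
  cases l
  · exact hZ (two (superpose_separating h))
  · exact hY (two (superpose_separating h))
  · exact hX (two (superpose_separating h))
  · exact hX h
  · exact hY h
  · exact hZ h

/-- The Kraus operators of each command have no common kernel on the reachable states, so that a
nonzero input state has a nonzero success branch. -/
lemma eq_zero_of_forall_run_eq_zero [Fintype V] (hrun : P.Runnable) {ψ : RegState V}
    (hψ : ∀ y, (∃ u ∉ P.inputs, y u ≠ 0) → ψ y = 0) (p q : List (Command V F P.outputs))
    (h : P.commands = p ++ q) (hz : ∀ m k, P.run β m k p ψ = 0) : ψ = 0 := by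
  classical
  induction p using List.reverseRecOn generalizing q with
  | nil => exact hz 0 0
  | append_singleton p c ih =>
    have h' : P.commands = p ++ (c :: q) := by simpa using h
    have hallowed := hrun _ _ _ h'
    refine ih _ h' fun m k => funext fun y => ?_
    have hz' : ∀ m k x, P.act β m k c (P.run β m k p ψ) x = 0 := fun m k x => by
      have := hz m k
      rw [run_append, run_cons, run_nil] at this
      rw [this]; rfl
    rw [Pi.zero_apply]
    cases c with
    | prepare i =>
      by_cases hy : y i = 0
      · have := hz' m k y
        change ketX 0 (y i) * P.run β m k p ψ (Function.update y i 0) = 0 at this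
        rw [← hy, Function.update_eq_self, ketX_apply] at this
        simpa [hy] using this
      · exact run_apply_eq_zero hrun hψ p _ h' hallowed hy
    | entangle i j hij =>
      have := hz' m k y
      change Gate.diag _ _ _ = _ at this
      rw [Gate.diag_apply] at this
      exact (mul_eq_zero.mp this).resolve_left (sgn_ne_zero _)
    | fuse f =>
      -- the outcome that agrees with the parity of the fused qubits in `y`
      have := hz' m (Function.update k f (y (P.ends f).1 + y (P.ends f).2)) y
      change Gate.fuse _ _ _ (Function.update k f _ f) _ _ = _ at this
      rw [Gate.fuse_apply, Function.update_self] at this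
      have hne : Gate.fuseEntry (P.fusionLabel f) 0 ≠ 0 := by
        cases P.fusionLabel f
        · simp [Gate.fuseEntry]
        · simp only [Gate.fuseEntry, sgn_zero, one_mul]
          intro h0
          have := congrArg Complex.re h0
          norm_num at this
      have h2 := (mul_eq_zero.mp this).resolve_left (by
        have e : (P.withAngles β).fusionLabel f = P.fusionLabel f := rfl
        have e' : (P.withAngles β).ends f = P.ends f := rfl
        rw [e, e', ZMod.add_self_two]; exact hne)
      rw [← h2]
      refine congrFun (run_congr hrun p [] _ h' (fun _ _ => rfl) (fun g hg => ?_) ψ) y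
      rw [Function.update_of_ne]
      rintro rfl
      exact hallowed.1 (by simp at hg; exact hg)
    | measure i =>
      have key : ∀ s, ∑ c, starRingEnd ℂ (ket (P.label i) (β i) s c) *
          P.run β m k p ψ (Function.update y i c) = 0 := by
        intro s
        have := hz' (Function.update m i s) k (Function.update y i 0)
        change Gate.project _ (ket (P.label i) (β i) (Function.update m i s i)) _ _ = _ at this
        rw [Gate.project_apply, Function.update_self, Function.update_self] at this
        simp only [Function.update_idem] at this
        rw [run_congr (m' := m) (k' := k) hrun p [] _ h' (fun j hj => ?_) (fun _ _ => rfl) ψ]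
          at this
        · simpa [ketZ] using this
        · rw [Function.update_of_ne]
          rintro rfl
          exact hallowed.2 j.2 (by simpa using hj)
      have := ket_separating key (y i)
      rwa [Function.update_eq_self] at this
    | corrX i s =>
      have := hz' m k (Function.update y i (y i + s.eval m k))
      change P.run β m k p ψ (Function.update (Function.update y i (y i + s.eval m k)) i
        (Function.update y i (y i + s.eval m k) i + s.eval m k)) = 0 at this
      rw [Function.update_idem, Function.update_self, add_assoc, ZMod.add_self_two, add_zero,
        Function.update_eq_self] at this
      exact this
    | corrZ i s =>
      have := hz' m k y
      change Gate.diag _ _ _ = _ at this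
      rw [Gate.diag_apply] at this
      exact (mul_eq_zero.mp this).resolve_left (sgn_ne_zero _)

/-! ### Dependence on the measurement angles -/

lemma _root_.continuous_superpose (u w : ZMod 2 → ℂ) (s c : ZMod 2) :
    Continuous fun α : ℝ => superpose u w α s c := by
  unfold superpose
  fun_prop

lemma _root_.continuous_ket (l : MeasLabel) (s c : ZMod 2) :
    Continuous fun α : ℝ => ket l α s c := by
  cases l
  · exact continuous_superpose _ _ _ _
  · exact continuous_superpose _ _ _ _
  · exact continuous_superpose _ _ _ _
  · exact continuous_const
  · exact continuous_const
  · exact continuous_const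

lemma continuous_act [Fintype V] {X : Type*} [TopologicalSpace X]
    {b : X → {v : V // v ∉ P.outputs} → MeasAngle} (hb : Continuous b) {Ψ : X → RegState V}
    (hΨ : Continuous Ψ) (c : Command V F P.outputs) :
    Continuous fun x => P.act (b x) m k c (Ψ x) := by
  have fixed : ∀ T : RegState V →ₗ[ℂ] RegState V, Continuous fun x => T (Ψ x) := fun T =>
    T.continuous_of_finiteDimensional.comp hΨ
  cases c with
  | measure i =>
    change Continuous fun x => Gate.project (i : V) (ket (P.label i) (b x i) (m i)) (Ψ x)
    refine continuous_pi fun y => ?_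
    simp only [Gate.project_apply]
    refine continuous_const.mul (continuous_finsetSum _ fun c _ => ?_)
    refine Continuous.mul ?_ ((continuous_apply _).comp hΨ)
    exact Complex.continuous_conj.comp ((continuous_ket _ _ _).comp
      (continuous_subtype_val.comp ((continuous_apply i).comp hb)))
  | prepare i => exact fixed (Gate.prepare i)
  | entangle i j hij => exact fixed (Gate.cz i j)
  | fuse f => exact fixed (Gate.fuse (P.ends f).1 (P.ends f).2 (P.fusionLabel f) (k f))
  | corrX i s => exact fixed (Gate.pauliX i (s.eval m k))
  | corrZ i s => exact fixed (Gate.pauliZ i (s.eval m k))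

lemma continuous_run [Fintype V] {X : Type*} [TopologicalSpace X]
    {b : X → {v : V // v ∉ P.outputs} → MeasAngle} (hb : Continuous b) {Ψ : X → RegState V}
    (hΨ : Continuous Ψ) (l : List (Command V F P.outputs)) :
    Continuous fun x => P.run (b x) m k l (Ψ x) := by
  induction l generalizing Ψ with
  | nil => exact hΨ
  | cons c l ih => exact ih (continuous_act hb hΨ c)

lemma run_congr_angles {l : List (Command V F P.outputs)}
    (h : ∀ i, Command.measure i ∈ l → β i = β' i) (ψ : RegState V) :
    P.run β m k l ψ = P.run β' m k l ψ := by
  induction l generalizing ψ with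
  | nil => rfl
  | cons c l ih =>
    have e : P.act β m k c = P.act β' m k c := by
      cases c with
      | measure i =>
        change Gate.project _ (ket _ (β i) _) = Gate.project _ (ket _ (β' i) _)
        rw [h i (by simp)]; rfl
      | _ => rfl
    rw [run_cons, run_cons, e]
    exact ih (fun i hi => h i (List.mem_cons_of_mem _ hi)) _

/-- For a planar measurement, the projection on a basis vector is an affine function of the phase
`e^{-iα}`, and the two outcomes correspond to opposite phases. -/
lemma _root_.exists_project_ket {V : Type*} [DecidableEq V] {l : MeasLabel} (hl : l.IsPlanar) :
    ∃ u w : ZMod 2 → ℂ, ∀ (i : V) (α : ℝ) (s : ZMod 2) (ψ : RegState V),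
      Gate.project i (ket l α s) ψ = Gate.project i u ψ +
        (sgn s * starRingEnd ℂ (Complex.exp (α * Complex.I))) • Gate.project i w ψ := by
  suffices H : ∀ U W : ZMod 2 → ℂ, ∃ u w : ZMod 2 → ℂ,
      ∀ (i : V) (α : ℝ) (s : ZMod 2) (ψ : RegState V),
        Gate.project i (superpose U W α s) ψ = Gate.project i u ψ +
          (sgn s * starRingEnd ℂ (Complex.exp (α * Complex.I))) • Gate.project i w ψ by
    cases l
    · exact H _ _
    · exact H _ _
    · exact H _ _
    all_goals exact hl.elim
  intro U W
  refine ⟨fun c => U c / (Real.sqrt 2 : ℂ), fun c => W c / (Real.sqrt 2 : ℂ),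
    fun i α s ψ => funext fun x => ?_⟩
  simp only [Gate.project_apply, Pi.add_apply, Pi.smul_apply, smul_eq_mul, Finset.mul_sum,
    ← Finset.sum_add_distrib]
  refine Finset.sum_congr rfl fun c _ => ?_
  simp only [superpose, map_div₀, map_add, map_mul, conj_sgn, Complex.conj_ofReal]
  ring

end Adaptive

end XYFusionPattern

namespace XYFusionPattern

section Obstruction

variable {V F : Type*} [DecidableEq V] {P : XYFusionPattern V F}

/-! ### Input states -/

omit [DecidableEq V] in
lemma embed_apply_of_mem (x : ({i : V // i ∈ P.inputs} → ZMod 2) → ℂ) {y : V → ZMod 2}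
    (hy : ∀ i ∉ P.inputs, y i = 0) : P.embed x y = x fun i => y i := by
  simp only [embed, LinearMap.pi_apply, if_pos hy, LinearMap.proj_apply]

omit [DecidableEq V] in
lemma embed_apply_of_notMem (x : ({i : V // i ∈ P.inputs} → ZMod 2) → ℂ) {y : V → ZMod 2}
    (hy : ¬ ∀ i ∉ P.inputs, y i = 0) : P.embed x y = 0 := by
  simp only [embed, LinearMap.pi_apply, if_neg hy, LinearMap.zero_apply]

omit [DecidableEq V] in
lemma embed_one_ne_zero : P.embed (fun _ => 1) ≠ 0 := by
  intro h
  have h1 := embed_apply_of_mem (P := P) (fun _ => 1) (y := 0) fun _ _ => rfl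
  rw [h] at h1
  exact zero_ne_one h1

lemma exists_embed_eq_pauliFrame [Fintype V] {a : V → ZMod 2} (ha : ∀ i ∉ P.inputs, a i = 0)
    (b : V → ZMod 2) (x : ({i : V // i ∈ P.inputs} → ZMod 2) → ℂ) :
    ∃ x', P.embed x' = pauliFrame a b (P.embed x) := by
  refine ⟨fun z => pauliFrame a b (P.embed x) fun i => if h : i ∈ P.inputs then z ⟨i, h⟩ else 0,
    funext fun y => ?_⟩
  by_cases hy : ∀ i ∉ P.inputs, y i = 0
  · rw [embed_apply_of_mem _ hy]
    have e : (fun i => if i ∈ P.inputs then y i else 0) = y := by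
      funext i
      by_cases hi : i ∈ P.inputs
      · exact if_pos hi
      · rw [if_neg hi, hy i hi]
    exact congrArg (pauliFrame a b (P.embed x)) e
  · rw [embed_apply_of_notMem _ hy, pauliFrame_apply, embed_apply_of_notMem, mul_zero]
    intro h
    refine hy fun i hi => ?_
    have := h i hi
    rwa [Pi.add_apply, ha i hi, add_zero] at this

/-! ### Flipping a single outcome -/

/-- The branch of `pre ++ c :: post` in which the command `c` has the outcome given by `m`, `k`
while all other commands, including the corrections that depend on `c`, are executed as for
outcome `0`. -/
noncomputable def flippedRun (P : XYFusionPattern V F)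
    (pre : List (Command V F P.outputs)) (c : Command V F P.outputs)
    (post : List (Command V F P.outputs)) (m : {v : V // v ∉ P.outputs} → ZMod 2) (k : F → ZMod 2)
    (β : {v : V // v ∉ P.outputs} → MeasAngle) : RegState V →ₗ[ℂ] RegState V :=
  P.run β 0 0 post ∘ₗ P.act β m k c ∘ₗ P.run β 0 0 pre

variable {pre post : List (Command V F P.outputs)} {c : Command V F P.outputs}
  {β β' : {v : V // v ∉ P.outputs} → MeasAngle}
  {m : {v : V // v ∉ P.outputs} → ZMod 2} {k : F → ZMod 2}

lemma flippedRun_zero (h : P.commands = pre ++ c :: post) (ψ : RegState V) :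
    P.flippedRun pre c post 0 0 β ψ = P.run β 0 0 P.commands ψ := by
  rw [h, run_append]; rfl

variable [Fintype V]

lemma StronglyDeterministicOnSuccess.run_ne_zero (hrun : P.Runnable)
    (hdet : (P.withAngles β).StronglyDeterministicOnSuccess)
    {x : ({i : V // i ∈ P.inputs} → ZMod 2) → ℂ} (hx : P.embed x ≠ 0) (m k) :
    P.run β m k P.commands (P.embed x) ≠ 0 := by
  obtain ⟨T, hT⟩ := hdet
  intro h0
  obtain ⟨d, hd, e⟩ := hT m k
  have e1 : P.run β m k P.commands (P.embed x) = d • T x := by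
    rw [← branch_apply]
    exact congrArg (fun L => L x) e
  have hd0 : d ≠ 0 := by rintro rfl; simp at hd
  have hTx : T x = 0 := (smul_eq_zero.mp (e1.symm.trans h0)).resolve_left hd0
  refine hx (eq_zero_of_forall_run_eq_zero (β := β) hrun (fun y hy => ?_) P.commands [] (by simp)
    fun m k => ?_)
  · refine embed_apply_of_notMem x fun h => ?_
    obtain ⟨u, hu, hyu⟩ := hy
    exact hyu (h u hu)
  · obtain ⟨d, -, e⟩ := hT m k
    have : P.run β m k P.commands (P.embed x) = d • T x := by
      rw [← branch_apply]
      exact congrArg (fun L => L x) e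
    rw [this, hTx, smul_zero]

/-- If all measurements after `c` have angle `0`, then by strong determinism flipping the outcome of
`c` only changes the branch by a Pauli operator and a phase. The Pauli operator does not depend on
the angles of the other measurements, but the phase may. -/
lemma exists_flippedRun_eq (hrun : P.Runnable)
    (hdet : ∀ β, (P.withAngles β).StronglyDeterministicOnSuccess)
    (h : P.commands = pre ++ c :: post) (hm : ∀ i, Command.measure i ≠ c → m i = 0)
    (hk : ∀ f, Command.fuse f ≠ c → k f = 0) :
    ∃ a b : V → ZMod 2, ∀ β : {v : V // v ∉ P.outputs} → MeasAngle,
      (∀ i, Command.measure i ∈ post → β i = MeasAngle.zero) → ∃ γ : ℂ, ‖γ‖ = 1 ∧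
        ∀ x, P.flippedRun pre c post 0 0 β (P.embed x) =
          γ • pauliFrame a b (P.flippedRun pre c post m k β (P.embed x)) := by
  have h' : P.commands = (pre ++ [c]) ++ post := by simpa using h
  obtain ⟨m', k', a, b, ρ, hm', hk', hρ, H⟩ := exists_run_pauliFrame hrun post (pre ++ [c]) h' 0 0
    (fun _ _ => rfl) 0 m 0 k
  refine ⟨a, b, fun β hβ => ?_⟩
  obtain ⟨T, hT⟩ := hdet β
  obtain ⟨d, hd, e⟩ := hT 0 0
  obtain ⟨d', hd', e'⟩ := hT m' k'
  have hd0 : d' ≠ 0 := by rintro rfl; simp at hd'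
  refine ⟨d * d'⁻¹ * ρ, by simp [hd, hd', hρ], fun x => ?_⟩
  have e1 : P.flippedRun pre c post 0 0 β (P.embed x) = d • T x := by
    rw [flippedRun_zero h, ← branch_apply]
    exact congrArg (fun L => L x) e
  have e2 : P.run β m' k' P.commands (P.embed x) = d' • T x := by
    rw [← branch_apply]
    exact congrArg (fun L => L x) e'
  have e3 : P.run β m' k' P.commands (P.embed x) =
      ρ • pauliFrame a b (P.flippedRun pre c post m k β (P.embed x)) := by
    rw [h', run_append, run_congr (m' := m) (k' := k) hrun (pre ++ [c]) [] post h'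
      (fun i hi => hm' i (hrun.measure_notMem h' hi)) (fun f hf => hk' f (hrun.fuse_notMem h' hf)),
      run_append, run_congr (m := m) (k := k) (m' := 0) (k' := 0) hrun pre [] (c :: post) h
      (fun i hi => hm i fun e => hrun.measure_notMem h hi (by simp [e]))
      (fun f hf => hk f fun e => hrun.fuse_notMem h hf (by simp [e]))]
    have := H β hβ (P.act β m k c (P.run β 0 0 pre (P.embed x)))
    rw [pauliFrame_zero] at this
    exact this
  rw [e1, mul_smul, ← e3, e2, smul_smul, mul_assoc, inv_mul_cancel₀ hd0, mul_one]

variable {A : V ⊕ F → ZMod 2} {J : V → ZMod 2}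

/-- A Pauli operator that passes through the pattern, ends in the identity, and picks up phases of
opposite sign for the two outcomes of `c` relates the phases of `exists_flippedRun_eq` at the angles
`β` and `β'` by a sign. -/
lemma IsWeb.factor_eq_neg (hrun : P.Runnable)
    (hdet : ∀ β, (P.withAngles β).StronglyDeterministicOnSuccess)
    (h : P.commands = pre ++ c :: post) (hweb : P.IsWeb A J β β')
    (hA : ∀ o ∈ P.outputs, A (.inl o) = 0)
    (hJ : ∀ o ∈ P.outputs, J o + (P.commands.map (P.kick A)).sum o = 0)
    (hc : ∃ ρ : ℂ, ρ ≠ 0 ∧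
      (∀ ψ, P.act β 0 0 c (pauliFrame (P.webX A pre) (P.webZ A J pre) ψ) =
        ρ • pauliFrame (P.webX A (pre ++ [c])) (P.webZ A J (pre ++ [c])) (P.act β' 0 0 c ψ)) ∧
      (∀ ψ, P.act β m k c (pauliFrame (P.webX A pre) (P.webZ A J pre) ψ) =
        (-ρ) • pauliFrame (P.webX A (pre ++ [c])) (P.webZ A J (pre ++ [c])) (P.act β' m k c ψ)))
    {a b : V → ZMod 2} {γ γ' : ℂ}
    (hγ : ∀ x, P.flippedRun pre c post 0 0 β (P.embed x) =
      γ • pauliFrame a b (P.flippedRun pre c post m k β (P.embed x)))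
    (hγ' : ∀ x, P.flippedRun pre c post 0 0 β' (P.embed x) =
      γ' • pauliFrame a b (P.flippedRun pre c post m k β' (P.embed x))) :
    γ' = -γ := by
  have h' : P.commands = (pre ++ [c]) ++ (post ++ []) := by simpa using h
  obtain ⟨ρ, hρ, h0, h1⟩ := hc
  obtain ⟨ρ₁, hρ₁, H₁⟩ := hweb.exists_run (m := 0) (k := 0) hrun pre [] (c :: post) h
  obtain ⟨ρ₂, hρ₂, H₂⟩ := hweb.exists_run (m := 0) (k := 0) hrun post (pre ++ [c]) [] h'
  have hX : P.webX A ((pre ++ [c]) ++ post) = 0 := by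
    funext u
    by_cases hu : u ∈ P.live ((pre ++ [c]) ++ post)
    · rw [webX_of_mem hu]
      exact hA u (mem_outputs_of_mem_live (by rw [h']; simpa using hu))
    · rw [webX_of_notMem hu]; rfl
  have hZ : P.webZ A J ((pre ++ [c]) ++ post) = 0 := by
    funext u
    by_cases hu : u ∈ P.live ((pre ++ [c]) ++ post)
    · rw [webZ_of_mem hu]
      have := hJ u (mem_outputs_of_mem_live (by rw [h']; simpa using hu))
      rw [h', List.append_nil] at this
      exact this
    · rw [webZ_of_notMem hu]; rfl
  rw [hX, hZ, pauliFrame_zero] at H₂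
  have L0 : ∀ ψ, P.flippedRun pre c post 0 0 β
      (pauliFrame (P.webX A []) (P.webZ A J []) ψ) =
      (ρ₁ * ρ * ρ₂) • P.flippedRun pre c post 0 0 β' ψ := by
    intro ψ
    simp only [flippedRun, LinearMap.comp_apply]
    rw [H₁, List.nil_append, map_smul, h0, map_smul, map_smul, H₂, smul_smul, smul_smul]
    rfl
  have L1 : ∀ ψ, P.flippedRun pre c post m k β
      (pauliFrame (P.webX A []) (P.webZ A J []) ψ) =
      (-(ρ₁ * ρ * ρ₂)) • P.flippedRun pre c post m k β' ψ := by
    intro ψ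
    simp only [flippedRun, LinearMap.comp_apply]
    rw [H₁, List.nil_append, map_smul, h1, map_smul, map_smul, H₂, smul_smul, smul_smul]
    simp
  have hx : P.embed (fun _ => 1) ≠ 0 := embed_one_ne_zero
  obtain ⟨x', hx'⟩ := exists_embed_eq_pauliFrame (P := P) (a := P.webX A []) (fun i hi =>
    webX_of_notMem (by rw [live_nil]; exact hi)) (P.webZ A J []) fun _ => 1
  set x : ({i : V // i ∈ P.inputs} → ZMod 2) → ℂ := fun _ => 1
  have hne : P.flippedRun pre c post 0 0 β' (P.embed x) ≠ 0 := by
    rw [flippedRun_zero h]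
    exact StronglyDeterministicOnSuccess.run_ne_zero hrun (hdet β') hx 0 0
  have e := hγ x'
  rw [hx', L0, L1, hγ' x, map_smul, smul_smul, smul_smul] at e
  have hw : pauliFrame a b (P.flippedRun pre c post m k β' (P.embed x)) ≠ 0 := by
    intro h0; apply hne; rw [hγ' x, h0, smul_zero]
  have e' : ρ₁ * ρ * ρ₂ * γ' = γ * -(ρ₁ * ρ * ρ₂) := smul_left_injective ℂ hw e
  have hρρ : ρ₁ * ρ * ρ₂ ≠ 0 := mul_ne_zero (mul_ne_zero hρ₁ hρ) hρ₂
  apply mul_left_cancel₀ hρρ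
  linear_combination e'

/-- For a planar measurement `i`, the phase of `exists_flippedRun_eq` has a constant square. -/
lemma sq_factor_eq (hrun : P.Runnable)
    (hdet : ∀ β, (P.withAngles β).StronglyDeterministicOnSuccess)
    {i : {v : V // v ∉ P.outputs}} (hi : (P.label i).IsPlanar)
    (h : P.commands = pre ++ Command.measure i :: post) {a b : V → ZMod 2}
    (hab : ∀ β : {v : V // v ∉ P.outputs} → MeasAngle,
      (∀ j, Command.measure j ∈ post → β j = MeasAngle.zero) → ∃ γ : ℂ, ‖γ‖ = 1 ∧
        ∀ x, P.flippedRun pre (.measure i) post 0 0 β (P.embed x) =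
          γ • pauliFrame a b (P.flippedRun pre (.measure i) post (Pi.single i 1) 0 β (P.embed x)))
    (hβ : ∀ j, Command.measure j ∈ post → β j = MeasAngle.zero) {γ : ℂ}
    (hγ : ∀ x, P.flippedRun pre (.measure i) post 0 0 β (P.embed x) =
      γ • pauliFrame a b (P.flippedRun pre (.measure i) post (Pi.single i 1) 0 β (P.embed x))) :
    γ ^ 2 * sgn (∑ u, b u * a u) = 1 := by
  obtain ⟨u, w, huw⟩ := exists_project_ket (V := V) hi
  have hpre : Command.measure i ∉ pre := fun hm => hrun.measure_notMem h hm (by simp)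
  have hpost : Command.measure i ∉ post :=
    hrun.measure_notMem (p := pre ++ [.measure i]) (by simpa using h) (by simp)
  have hx : P.embed (fun _ => 1) ≠ 0 := embed_one_ne_zero
  set x : ({i : V // i ∈ P.inputs} → ZMod 2) → ℂ := fun _ => 1
  set φ := P.run β 0 0 pre (P.embed x) with hφ
  set a' := P.run β 0 0 post (Gate.project (i : V) u φ)
  set b' := P.run β 0 0 post (Gate.project (i : V) w φ)
  have update_pre : ∀ (α : MeasAngle) (j), Command.measure j ∈ pre →
      Function.update β i α j = β j := fun α j hj =>
    Function.update_of_ne (by rintro rfl; exact hpre hj) _ _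
  have update_post : ∀ (α : MeasAngle) (j), Command.measure j ∈ post →
      Function.update β i α j = β j := fun α j hj =>
    Function.update_of_ne (by rintro rfl; exact hpost hj) _ _
  have affine : ∀ (α : MeasAngle) (m : {v : V // v ∉ P.outputs} → ZMod 2),
      P.flippedRun pre (.measure i) post m 0 (Function.update β i α) (P.embed x) =
        a' + (sgn (m i) * starRingEnd ℂ (Complex.exp ((α : ℝ) * Complex.I))) • b' := by
    intro α m
    have e1 : P.run (Function.update β i α) 0 0 pre (P.embed x) = φ :=
      run_congr_angles (update_pre α) _
    have e2 : ∀ ψ, P.run (Function.update β i α) 0 0 post ψ = P.run β 0 0 post ψ := fun ψ =>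
      run_congr_angles (update_post α) _
    have e3 : ∀ ψ, P.act (Function.update β i α) m 0 (.measure i) ψ =
        Gate.project (i : V) (ket (P.label i) α (m i)) ψ := by
      intro ψ
      change Gate.project _ (ket _ (Function.update β i α i) _) _ = _
      rw [Function.update_self]; rfl
    simp only [flippedRun, LinearMap.comp_apply]
    rw [e1, e2, e3, huw, map_add, map_smul]
  have hβ' : ∀ α j, Command.measure j ∈ post → Function.update β i α j = MeasAngle.zero :=
    fun α j hj => by rw [update_post α j hj, hβ j hj]
  have angle : ∀ z : ℂ, ‖z‖ = 1 →
      ∃ α : MeasAngle, starRingEnd ℂ (Complex.exp ((α : ℝ) * Complex.I)) = z := by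
    intro z hz
    obtain ⟨α, hα⟩ := exists_measAngle_exp (w := starRingEnd ℂ z) (by simpa using hz)
    exact ⟨α, by rw [hα, Complex.conj_conj]⟩
  have plus : ∀ α : MeasAngle,
      P.flippedRun pre (.measure i) post 0 0 (Function.update β i α) (P.embed x) =
        a' + starRingEnd ℂ (Complex.exp ((α : ℝ) * Complex.I)) • b' := fun α => by
    simpa using affine α 0
  have minus : ∀ α : MeasAngle,
      P.flippedRun pre (.measure i) post (Pi.single i 1) 0 (Function.update β i α) (P.embed x) =
        a' - starRingEnd ℂ (Complex.exp ((α : ℝ) * Complex.I)) • b' := fun α => by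
    rw [affine α (Pi.single i 1), Pi.single_eq_same, sgn_one, neg_one_mul, neg_smul,
      sub_eq_add_neg]
  refine sq_mul_eq_one_of_unimodular (C := pauliFrame a b) (a := a') (b := b')
    (z := starRingEnd ℂ (Complex.exp ((β i : ℝ) * Complex.I)))
    (pauliFrame_pauliFrame a b) ?_ (fun z hz => ?_) (fun z hz => ?_) ?_ ?_
  · intro ψ
    have := congrArg (fun r : ℝ => (r : ℂ)) (sum_normSq_pauliFrame a b ψ)
    push_cast at this
    simpa [dotProduct, Complex.conj_mul'] using this
  · obtain ⟨α, rfl⟩ := angle z hz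
    rw [← plus α, flippedRun_zero h]
    exact StronglyDeterministicOnSuccess.run_ne_zero hrun (hdet _) hx 0 0
  · obtain ⟨α, rfl⟩ := angle z hz
    obtain ⟨d, hd, e⟩ := hab (Function.update β i α) (hβ' α)
    exact ⟨d, hd, by rw [← plus α, ← minus α]; exact e x⟩
  · rw [RCLike.norm_conj]; exact norm_exp_measAngle _
  · rw [← plus, ← minus, Function.update_eq_self]; exact hγ x

/-- For a planar measurement the phase of `exists_flippedRun_eq` does not depend on the angles. -/
lemma factor_eq (hrun : P.Runnable)
    (hdet : ∀ β, (P.withAngles β).StronglyDeterministicOnSuccess)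
    {i : {v : V // v ∉ P.outputs}} (hi : (P.label i).IsPlanar)
    (h : P.commands = pre ++ Command.measure i :: post) {a b : V → ZMod 2}
    (hab : ∀ β : {v : V // v ∉ P.outputs} → MeasAngle,
      (∀ j, Command.measure j ∈ post → β j = MeasAngle.zero) → ∃ γ : ℂ, ‖γ‖ = 1 ∧
        ∀ x, P.flippedRun pre (.measure i) post 0 0 β (P.embed x) =
          γ • pauliFrame a b (P.flippedRun pre (.measure i) post (Pi.single i 1) 0 β (P.embed x)))
    (hβ : ∀ j, Command.measure j ∈ post → β j = MeasAngle.zero)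
    (hβ' : ∀ j, Command.measure j ∈ post → β' j = MeasAngle.zero) {γ γ' : ℂ}
    (hγ : ∀ x, P.flippedRun pre (.measure i) post 0 0 β (P.embed x) =
      γ • pauliFrame a b (P.flippedRun pre (.measure i) post (Pi.single i 1) 0 β (P.embed x)))
    (hγ' : ∀ x, P.flippedRun pre (.measure i) post 0 0 β' (P.embed x) =
      γ' • pauliFrame a b (P.flippedRun pre (.measure i) post (Pi.single i 1) 0 β' (P.embed x))) :
    γ = γ' := by
  classical
  have hx : P.embed (fun _ => 1) ≠ 0 := embed_one_ne_zero
  set x : ({i : V // i ∈ P.inputs} → ZMod 2) → ℂ := fun _ => 1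
  -- angles with value `0` at the later measurements
  let mask : ({v : V // v ∉ P.outputs} → MeasAngle) → {v : V // v ∉ P.outputs} → MeasAngle :=
    fun β j => if Command.measure j ∈ post then MeasAngle.zero else β j
  have hmask : ∀ β j, Command.measure j ∈ post → mask β j = MeasAngle.zero :=
    fun β j hj => if_pos hj
  have hmask_eq : ∀ β : {v : V // v ∉ P.outputs} → MeasAngle,
      (∀ j, Command.measure j ∈ post → β j = MeasAngle.zero) → mask β = β := by
    intro β hβ
    funext j
    by_cases hj : Command.measure j ∈ post
    · rw [hmask β j hj, hβ j hj]
    · exact if_neg hj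
  have hcont : Continuous mask := by
    refine continuous_pi fun j => ?_
    by_cases hj : Command.measure j ∈ post
    · simp only [mask, if_pos hj]; exact continuous_const
    · simp only [mask, if_neg hj]; exact continuous_apply j
  have : PreconnectedSpace MeasAngle := Subtype.preconnectedSpace isPreconnected_Ico
  have cont : ∀ m : {v : V // v ∉ P.outputs} → ZMod 2, Continuous fun β =>
      P.flippedRun pre (.measure i) post m 0 (mask β) (P.embed x) := fun m => by
    change Continuous fun β => P.run (mask β) 0 0 post
      (P.act (mask β) m 0 (.measure i) (P.run (mask β) 0 0 pre (P.embed x)))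
    exact continuous_run hcont (continuous_act hcont (continuous_run hcont continuous_const _) _) _
  choose c hc hcx using fun β => hab (mask β) (hmask β)
  have e : ∀ β : {v : V // v ∉ P.outputs} → MeasAngle,
      (∀ j, Command.measure j ∈ post → β j = MeasAngle.zero) → ∀ {γ : ℂ},
      (∀ x, P.flippedRun pre (.measure i) post 0 0 β (P.embed x) =
        γ • pauliFrame a b
          (P.flippedRun pre (.measure i) post (Pi.single i 1) 0 β (P.embed x))) → γ = c β := by
    intro β hβ γ hγ
    have h1 := hcx β x
    rw [hmask_eq β hβ, hγ x] at h1
    refine smul_left_injective ℂ (fun h0 => ?_) h1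
    refine StronglyDeterministicOnSuccess.run_ne_zero hrun (hdet β) hx 0 0 ?_
    rw [← flippedRun_zero h, hγ x, h0, smul_zero]
  rw [e β hβ hγ, e β' hβ' hγ']
  refine factor_eq_of_sq_eq (cont 0)
    ((pauliFrame a b).continuous_of_finiteDimensional.comp (cont (Pi.single i 1)))
    (fun β h0 => ?_) (fun β => hcx β x) (g := sgn (∑ u, b u * a u)) (sgn_ne_zero _)
    (fun β => ?_) β β'
  · refine StronglyDeterministicOnSuccess.run_ne_zero hrun (hdet (mask β)) hx 0 0 ?_
    rw [← flippedRun_zero h, hcx β x]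
    exact smul_eq_zero_of_right _ h0
  · have := sq_factor_eq hrun hdet hi h hab (hmask β) (hcx β)
    calc c β ^ 2 = c β ^ 2 * sgn (∑ u, b u * a u) * sgn (∑ u, b u * a u) := by
          rw [mul_assoc, sgn_mul_self, mul_one]
      _ = sgn (∑ u, b u * a u) := by rw [this, one_mul]

end Obstruction

end XYFusionPattern

namespace XYFusionPattern

section NoObstruction

variable {V F : Type*} [DecidableEq V] [Fintype V] {P : XYFusionPattern V F}
variable {A : V ⊕ F → ZMod 2} {J : V → ZMod 2}
  {pre post : List (Command V F P.outputs)}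

/-! ### Closed webs -/

/-- The exponents `A`, `J` define a Pauli operator that passes through the pattern, ends in the
identity, and is compatible with the labels of all measurements and fusions. -/
structure IsClosedWeb (P : XYFusionPattern V F) (A : V ⊕ F → ZMod 2) (J : V → ZMod 2) : Prop where
  zero_of_notMem : ∀ u ∉ P.inputs, J u = 0
  fuse : ∀ f, (A (.inr f), A (.inl (P.ends f).1) + A (.inl (P.ends f).2)) ∈
    (P.fusionLabel f).toMeasLabel.compatible
  measure : ∀ i : {v : V // v ∉ P.outputs},
    (A (.inl i), J i + (P.commands.map (P.kick A)).sum i) ∈ (P.label i).compatible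
  output_left : ∀ o ∈ P.outputs, A (.inl o) = 0
  output_right : ∀ o ∈ P.outputs, J o + (P.commands.map (P.kick A)).sum o = 0

omit [Fintype V] in
/-- The new angles can be chosen to differ from the old ones only at planar measurements on which
the Pauli operator acts nontrivially. -/
lemma IsClosedWeb.exists_isWeb (hweb : P.IsClosedWeb A J)
    (β : {v : V // v ∉ P.outputs} → MeasAngle) :
    ∃ β', P.IsWeb A J β β' ∧ ∀ i, (¬ (P.label i).IsPlanar ∨
      (A (.inl i) = 0 ∧ J i + (P.commands.map (P.kick A)).sum i = 0)) → β' i = β i := by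
  choose β' ρ hρ hβ' H using fun i => exists_braShift_ket (P.label i) (hweb.measure i) (β i)
  exact ⟨β', ⟨hweb.zero_of_notMem, hweb.fuse, fun i => ⟨ρ i, hρ i, H i⟩⟩, hβ'⟩

/-- If a closed web acts trivially on all later planar measurements, and on all planar measurements
in case `i` is a Pauli measurement, then it commutes with the operator that flips the outcome
of `i`. -/
lemma IsClosedWeb.pairing_measure_eq_zero (hrun : P.Runnable)
    (hdet : ∀ β, (P.withAngles β).StronglyDeterministicOnSuccess) (hweb : P.IsClosedWeb A J)
    {i : {v : V // v ∉ P.outputs}} (h : P.commands = pre ++ Command.measure i :: post)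
    (hzero : ∀ j, (P.label j).IsPlanar → Command.measure j ∈ post ∨ ¬ (P.label i).IsPlanar →
      A (.inl j) = 0 ∧ J j + (P.commands.map (P.kick A)).sum j = 0) :
    (P.label i).pairing (A (.inl i), J i + (P.commands.map (P.kick A)).sum i) = 0 := by
  by_contra hne
  obtain ⟨β, hβ⟩ : ∃ β : {v : V // v ∉ P.outputs} → MeasAngle, ∀ i, β i = MeasAngle.zero :=
    ⟨_, fun _ => rfl⟩
  have hone := (zmod_two_cases _).resolve_left hne
  obtain ⟨β', hβ', hβ'_eq⟩ := hweb.exists_isWeb β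
  have hpost : ∀ j, Command.measure j ∈ post → β' j = MeasAngle.zero := fun j hj =>
    (hβ'_eq j (or_iff_not_imp_left.mpr fun hp => hzero j (not_not.mp hp) (.inl hj))).trans (hβ j)
  obtain ⟨a, b, H⟩ := exists_flippedRun_eq (m := Pi.single i 1) (k := 0) hrun hdet h
    (fun j hj => Pi.single_eq_of_ne (fun e => hj (by rw [e])) _) fun _ _ => rfl
  obtain ⟨γ, hγ1, hγ⟩ := H β fun j _ => hβ j
  obtain ⟨γ', -, hγ'⟩ := H β' hpost
  obtain ⟨ρ, hρ, hρ'⟩ := hβ'.measure i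
  rw [hone] at hρ'
  have hc : ∀ (m : {v : V // v ∉ P.outputs} → ZMod 2) (k : F → ZMod 2) (ψ : RegState V),
      P.act β m k (.measure i)
        (pauliFrame (P.webX A pre) (P.webZ A J pre) ψ) =
      (sgn (m i * 1) * ρ) • pauliFrame (P.webX A (pre ++ [.measure i]))
        (P.webZ A J (pre ++ [.measure i])) (P.act β' m k (.measure i) ψ) := fun m k ψ =>
    exists_act_measure_web hrun h hρ' ψ
  have key : ∀ {δ : ℂ}, (∀ x, P.flippedRun pre (.measure i) post 0 0 β' (P.embed x) =
      δ • pauliFrame a b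
        (P.flippedRun pre (.measure i) post (Pi.single i 1) 0 β' (P.embed x))) → δ = -γ :=
    hβ'.factor_eq_neg hrun hdet h hweb.output_left hweb.output_right
      ⟨ρ, hρ, fun ψ => by simpa using hc 0 0 ψ,
        fun ψ => by simpa using hc (Pi.single i 1) 0 ψ⟩ hγ
  have hγ0 : γ ≠ -γ := fun e => by
    rw [self_eq_neg.mp e] at hγ1
    simp at hγ1
  by_cases hi : (P.label i).IsPlanar
  · exact hγ0 ((factor_eq hrun hdet hi h H (fun j _ => hβ j) hpost hγ hγ').trans (key hγ'))
  · have e : β' = β := funext fun j =>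
      hβ'_eq j (or_iff_not_imp_left.mpr fun hp => hzero j (not_not.mp hp) (.inr hi))
    exact hγ0 (key (by rw [e]; exact hγ))

/-- A closed web that acts trivially on all planar measurements commutes with the operator that
flips the outcome of a fusion. -/
lemma IsClosedWeb.pairing_fuse_eq_zero (hrun : P.Runnable)
    (hdet : ∀ β, (P.withAngles β).StronglyDeterministicOnSuccess) (hweb : P.IsClosedWeb A J)
    (f : F) (hzero : ∀ j, (P.label j).IsPlanar →
      A (.inl j) = 0 ∧ J j + (P.commands.map (P.kick A)).sum j = 0) :
    (P.fusionLabel f).toMeasLabel.pairing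
      (A (.inr f), A (.inl (P.ends f).1) + A (.inl (P.ends f).2)) = 0 := by
  classical
  by_contra hne
  have hone := (zmod_two_cases _).resolve_left hne
  obtain ⟨pre, post, h⟩ := List.append_of_mem (P.fused f)
  obtain ⟨β', hβ', hβ'_eq⟩ := hweb.exists_isWeb fun _ => MeasAngle.zero
  have e : β' = fun _ => MeasAngle.zero := funext fun j =>
    hβ'_eq j (or_iff_not_imp_left.mpr fun hp => hzero j (not_not.mp hp))
  rw [e] at hβ'
  obtain ⟨a, b, H⟩ := exists_flippedRun_eq (m := 0) (k := Pi.single f 1) hrun hdet h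
    (fun _ _ => rfl) fun g hg => Pi.single_eq_of_ne (fun e => hg (by rw [e])) _
  obtain ⟨γ, hγ1, hγ⟩ := H (fun _ => MeasAngle.zero) fun _ _ => rfl
  obtain ⟨ρ, hρ, hc⟩ := exists_act_fuse_web (β := fun _ => MeasAngle.zero)
    (β' := fun _ => MeasAngle.zero) (J := J) hrun h (hweb.fuse f)
  rw [hone] at hc
  have key := hβ'.factor_eq_neg hrun hdet h hweb.output_left hweb.output_right
    (m := 0) (k := Pi.single f 1) (a := a) (b := b)
    ⟨ρ, hρ, fun ψ => by simpa using hc 0 0 ψ, fun ψ => by simpa using hc 0 (Pi.single f 1) ψ⟩ hγ hγ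
  rw [self_eq_neg.mp key] at hγ1
  simp at hγ1

end NoObstruction

/-! ### The accumulated change of a Pauli operator -/

section Kick

variable {V F : Type*} [DecidableEq V] {P : XYFusionPattern V F}

/-- The fusion performed by a command. -/
def _root_.Command.fusion {V F : Type*} {O : Finset V} : Command V F O → Option F
  | .fuse f => some f
  | _ => none

/-- The contribution of the `CZ` gate on an edge to the exponent of `Z` on the qubit `u`, which is
the sum of the exponents of `X` on the opposite ends. -/
def edgeKick [Fintype V] (A : V → ZMod 2) (u : V) (e : Sym2 V) : ZMod 2 :=
  ∑ w, if u ≠ w ∧ e = s(u, w) then A w else 0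

lemma edgeKick_mk [Fintype V] (A : V → ZMod 2) (u : V) {i j : V} (h : i ≠ j) :
    edgeKick A u s(i, j) = (Pi.single i (A j) + Pi.single j (A i) : V → ZMod 2) u := by
  rw [edgeKick, Pi.add_apply]
  by_cases hi : u = i
  · subst hi
    rw [Finset.sum_eq_single j, if_pos ⟨h, rfl⟩, Pi.single_eq_same, Pi.single_eq_of_ne h, add_zero]
    · intro w _ hw
      rw [if_neg]
      rintro ⟨-, e⟩
      exact hw (Sym2.congr_right.mp e.symm)
    · simp
  · by_cases hj : u = j
    · subst hj
      rw [Finset.sum_eq_single i, if_pos ⟨Ne.symm h, Sym2.eq_swap⟩, Pi.single_eq_same,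
        Pi.single_eq_of_ne hi, zero_add]
      · intro w _ hw
        rw [if_neg]
        rintro ⟨-, e⟩
        rw [Sym2.eq_swap] at e
        exact hw (Sym2.congr_right.mp e.symm)
      · simp
    · rw [Pi.single_eq_of_ne hi, Pi.single_eq_of_ne hj, add_zero]
      refine Finset.sum_eq_zero fun w _ => if_neg ?_
      rintro ⟨-, e⟩
      have : u ∈ s(i, j) := by rw [e]; simp
      simp [hi, hj] at this

lemma sum_edgeKick [Fintype V] (A : V → ZMod 2) (u : V) (l : List (Sym2 V)) :
    (l.map (edgeKick A u)).sum = ∑ w, if u ≠ w ∧ Odd (l.count s(u, w)) then A w else 0 := by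
  have : ∀ w, (if u ≠ w ∧ Odd (l.count s(u, w)) then A w else 0) =
      if u ≠ w then (l.count s(u, w) : ZMod 2) * A w else 0 := by
    intro w
    by_cases hw : u = w
    · simp [hw]
    · by_cases ho : Odd (l.count s(u, w))
      · simp [hw, ho, ZMod.natCast_eq_one_iff_odd.mpr ho]
      · simp [hw, ho, ZMod.natCast_eq_zero_iff_even.mpr (Nat.not_odd_iff_even.mp ho)]
  rw [Finset.sum_congr rfl fun w _ => this w]
  clear this
  induction l with
  | nil => simp
  | cons e l ih =>
    rw [List.map_cons, List.sum_cons, ih, edgeKick, ← Finset.sum_add_distrib]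
    refine Finset.sum_congr rfl fun w _ => ?_
    by_cases hw : u = w
    · simp [hw]
    · rw [List.count_cons]
      by_cases he : e = s(u, w)
      · simp [hw, he]; ring
      · simp [hw, he]

lemma sum_kick_apply [Fintype V] (A : V ⊕ F → ZMod 2) (u : V) (l : List (Command V F P.outputs)) :
    (l.map (P.kick A)).sum u =
      ((l.filterMap Command.edge).map (edgeKick (fun w => A (.inl w)) u)).sum +
      ((l.filterMap Command.fusion).map fun f => P.kick A (.fuse f) u).sum := by
  induction l with
  | nil => simp
  | cons c l ih =>
    rw [List.map_cons, List.sum_cons, Pi.add_apply, ih]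
    cases c with
    | entangle i j h =>
      simp only [List.filterMap_cons, Command.edge, Command.fusion, List.map_cons, List.sum_cons,
        edgeKick_mk _ _ h]
      simp only [kick]; ring
    | fuse f =>
      simp only [List.filterMap_cons, Command.edge, Command.fusion, List.map_cons, List.sum_cons]
      ring
    | _ => simp [List.filterMap_cons, Command.edge, Command.fusion, kick]

omit [DecidableEq V] in
lemma Runnable.nodup_fusion (hrun : P.Runnable) :
    (P.commands.filterMap Command.fusion).Nodup := by
  suffices H : ∀ q p, P.commands = p ++ q → (q.filterMap Command.fusion).Nodup from
    H _ [] rfl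
  intro q
  induction q with
  | nil => intro p _; simp
  | cons c q ih =>
    intro p h
    have h' : P.commands = (p ++ [c]) ++ q := by simpa using h
    have hq := ih _ h'
    cases c with
    | fuse f =>
      simp only [List.filterMap_cons, Command.fusion, List.nodup_cons]
      refine ⟨fun hm => ?_, hq⟩
      obtain ⟨d, hd, e⟩ := List.mem_filterMap.mp hm
      have : d = .fuse f := by
        cases d with
        | fuse g => simpa [Command.fusion] using e
        | _ => simp [Command.fusion] at e
      exact hrun.fuse_notMem h' (by simp) (this ▸ hd)
    | _ => simpa [List.filterMap_cons, Command.fusion] using hq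

variable [Fintype V] [Fintype F]

/-- At the end of the pattern the exponent of `Z` on a qubit has changed by the sum of the exponents
of `X` on its neighbours in the target open graph. -/
lemma Runnable.sum_kick_eq_oddSum (hrun : P.Runnable) (A : V ⊕ F → ZMod 2) (u : V) :
    (P.commands.map (P.kick A)).sum u = oddSum P.network.target.graph A (.inl u) := by
  classical
  have hfus : (P.commands.filterMap Command.fusion).toFinset = Finset.univ := by
    ext f
    simp only [List.mem_toFinset, List.mem_filterMap, Finset.mem_univ, iff_true]
    exact ⟨_, P.fused f, rfl⟩
  rw [sum_kick_apply, sum_edgeKick, ← List.sum_toFinset _ hrun.nodup_fusion, hfus, oddSum,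
    Fintype.sum_sum_type]
  congr 1
  · refine Finset.sum_congr rfl fun w _ => ?_
    congr 1
  · refine Finset.sum_congr rfl fun f _ => ?_
    have e : P.network.target.graph.Adj (.inl u) (.inr f) ↔
      u = (P.ends f).1 ∨ u = (P.ends f).2 := Iff.rfl
    have hne : ((P.ends f).1 : V) ≠ (P.ends f).2 := fun h => P.ends_ne f (Subtype.ext h)
    simp only [e, kick, Pi.add_apply]
    by_cases h1 : u = (P.ends f).1
    · subst h1; simp [hne]
    · by_cases h2 : u = (P.ends f).2
      · subst h2; simp [h1]
      · simp [h1, h2]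

lemma oddSum_inr (A : V ⊕ F → ZMod 2) (f : F) :
    oddSum P.network.target.graph A (.inr f) =
      A (.inl (P.ends f).1) + A (.inl (P.ends f).2) := by
  classical
  have e : ∀ u, P.network.target.graph.Adj (.inr f) (.inl u) ↔
    u = (P.ends f).1 ∨ u = (P.ends f).2 := fun _ => Iff.rfl
  have e' : ∀ g, ¬ P.network.target.graph.Adj (.inr f) (.inr g) := fun _ h => h
  have hne : ((P.ends f).1 : V) ≠ (P.ends f).2 := fun h => P.ends_ne f (Subtype.ext h)
  rw [oddSum, Fintype.sum_sum_type, Finset.sum_eq_zero (s := (Finset.univ : Finset F))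
    (fun g _ => if_neg (e' g)), add_zero, ← Finset.sum_filter,
    ← Finset.sum_pair hne (f := fun u => A (.inl u))]
  refine Finset.sum_congr ?_ fun _ _ => rfl
  ext u
  simp [e]

end Kick

end XYFusionPattern

namespace XYFusionPattern

section Flow

variable {V F : Type*} [DecidableEq V] (P : XYFusionPattern V F)

/-! ### Labels and order of the target open graph -/

/-- The label of a vertex of the target open graph; outputs have none. -/
def targetLabel : V ⊕ F → Option MeasLabel
  | .inl v => if h : v ∈ P.outputs then none else some (P.label ⟨v, h⟩)
  | .inr f => some (P.fusionLabel f).toMeasLabel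

open Classical in
/-- A position in the order of corrections: outcomes of fusions and Pauli measurements, whose
results may be reinterpreted at any time, come first, then the planar measurements in their order of
execution, and finally the outputs. -/
noncomputable def rank : V ⊕ F → ℕ
  | .inl v => if h : v ∈ P.outputs then P.commands.length + 1 else
      if (P.label ⟨v, h⟩).IsPlanar then P.commands.idxOf (Command.measure ⟨v, h⟩) + 1 else 0
  | .inr _ => 0

variable {P}

lemma targetLabel_inl (i : {v : V // v ∉ P.outputs}) :
    P.targetLabel (.inl i) = some (P.label i) :=
  dif_neg i.2

lemma targetLabel_of_mem_outputs {v : V} (h : v ∈ P.outputs) : P.targetLabel (.inl v) = none :=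
  dif_pos h

lemma hasLabel_iff (w : V ⊕ F) (l : MeasLabel) :
    P.network.target.HasLabel w l ↔ P.targetLabel w = some l := by
  rcases w with v | f
  · by_cases h : v ∈ P.outputs
    · rw [targetLabel_of_mem_outputs h]
      refine ⟨fun ⟨h', _⟩ => absurd ⟨v, h, rfl⟩ h', fun h' => by cases h'⟩
    · rw [targetLabel_inl ⟨v, h⟩, Option.some_inj]
      refine ⟨fun ⟨_, e⟩ => e, fun e => ⟨fun ⟨_, hu, e'⟩ => h (Sum.inl_injective e' ▸ hu), e⟩⟩
  · rw [targetLabel, Option.some_inj]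
    exact ⟨fun ⟨_, e⟩ => e, fun e => ⟨fun ⟨_, _, e'⟩ => Sum.inl_ne_inr e', e⟩⟩

lemma exists_targetLabel {w : V ⊕ F} (h : w ∉ P.network.target.outputs) :
    ∃ l, P.targetLabel w = some l :=
  ⟨_, (hasLabel_iff w _).mp ⟨h, rfl⟩⟩

lemma rank_of_mem_outputs {v : V} (h : v ∈ P.outputs) :
    P.rank (.inl v) = P.commands.length + 1 :=
  dif_pos h

open Classical in
lemma rank_of_isPlanar {i : {v : V // v ∉ P.outputs}} (h : (P.label i).IsPlanar) :
    P.rank (.inl i) = P.commands.idxOf (Command.measure i) + 1 := by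
  rw [rank, dif_neg i.2, if_pos h]

lemma rank_of_not_isPlanar {i : {v : V // v ∉ P.outputs}} (h : ¬ (P.label i).IsPlanar) :
    P.rank (.inl i) = 0 := by
  rw [rank, dif_neg i.2, if_neg h]

/-- Outputs come after all other vertices. -/
lemma rank_lt_of_targetLabel {v w : V ⊕ F} {l : MeasLabel} (hv : P.targetLabel v = some l)
    (hw : P.targetLabel w = none) : P.rank v < P.rank w := by
  classical
  rcases w with w | f
  · have hw' : w ∈ P.outputs := by
      by_contra h
      rw [targetLabel_inl ⟨w, h⟩] at hw
      cases hw
    rw [rank_of_mem_outputs hw']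
    rcases v with v | f
    · by_cases h : v ∈ P.outputs
      · rw [targetLabel_of_mem_outputs h] at hv
        cases hv
      · by_cases hp : (P.label ⟨v, h⟩).IsPlanar
        · rw [rank_of_isPlanar (i := ⟨v, h⟩) hp]
          exact Nat.succ_lt_succ (List.idxOf_lt_length_of_mem (P.measured _))
        · rw [rank_of_not_isPlanar (i := ⟨v, h⟩) hp]
          exact Nat.succ_pos _
    · exact Nat.succ_pos _
  · cases hw

lemma Runnable.rank_lt_of_mem (hrun : P.Runnable) {pre post : List (Command V F P.outputs)}
    {i j : {v : V // v ∉ P.outputs}} (h : P.commands = pre ++ Command.measure i :: post)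
    (hj : Command.measure j ∈ post) (hpj : (P.label j).IsPlanar) :
    P.rank (.inl i) < P.rank (.inl j) := by
  classical
  rw [rank_of_isPlanar hpj]
  by_cases hpi : (P.label i).IsPlanar
  · rw [rank_of_isPlanar hpi]
    have hi' : Command.measure i ∉ pre := fun hm => hrun.measure_notMem h hm (by simp)
    have hj' : Command.measure j ∉ pre := fun hm => hrun.measure_notMem h hm (by simp [hj])
    have hij : Command.measure i ≠ (Command.measure j : Command V F P.outputs) := fun e =>
      hrun.measure_notMem (p := pre ++ [.measure i]) (by simpa using h) (by simp) (e ▸ hj)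
    rw [h, List.idxOf_append_of_notMem hi', List.idxOf_append_of_notMem hj', List.idxOf_cons_self,
      List.idxOf_cons_ne _ hij]
    omega
  · rw [rank_of_not_isPlanar hpi]
    exact Nat.succ_pos _

/-! ### Correction sets -/

lemma _root_.MeasLabel.pairing_eq (l : MeasLabel) (r : ZMod 2 × ZMod 2) :
    l.pairing r = r.1 * l.flip.2 + r.2 * l.flip.1 := by
  cases l <;> simp [MeasLabel.pairing, MeasLabel.flip]

lemma _root_.MeasLabel.one_zero_mem_compatible {l : MeasLabel} (h1 : l ≠ .Y) (h2 : l ≠ .Z) :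
    (1, 0) ∈ l.compatible := by
  cases l
  case Y => exact absurd rfl h1
  case Z => exact absurd rfl h2
  case X => exact LinearMap.mem_ker.mpr rfl
  all_goals exact Submodule.mem_top

lemma _root_.MeasLabel.zero_one_mem_compatible {l : MeasLabel} (h1 : l ≠ .X) (h2 : l ≠ .Y) :
    (0, 1) ∈ l.compatible := by
  cases l
  case X => exact absurd rfl h1
  case Y => exact absurd rfl h2
  case Z => exact LinearMap.mem_ker.mpr rfl
  all_goals exact Submodule.mem_top

lemma _root_.MeasLabel.one_one_mem_compatible : (1, 1) ∈ MeasLabel.Y.compatible :=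
  LinearMap.mem_ker.mpr rfl

variable [Fintype V] [Fintype F]

/-- A Pauli operator on the target open graph whose exponents satisfy the equations of a stabilizer
away from the inputs passes through the pattern. -/
lemma isClosedWeb_of_eq_oddSum (hrun : P.Runnable) {R : V ⊕ F → ZMod 2 × ZMod 2}
    (hR : ∀ u, R u ∈ (P.targetLabel u).elim ⊥ MeasLabel.compatible)
    (hodd : ∀ u ∉ P.network.target.inputs,
      (R u).2 = oddSum P.network.target.graph (fun w => (R w).1) u) :
    P.IsClosedWeb (fun w => (R w).1)
      fun u => (R (.inl u)).2 + oddSum P.network.target.graph (fun w => (R w).1) (.inl u) where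
  zero_of_notMem u hu := by
    rw [hodd (.inl u) fun ⟨v, hv, e⟩ => hu (Sum.inl_injective e ▸ hv), ZMod.add_self_two]
  fuse f := by
    rw [← oddSum_inr (fun w => (R w).1), ← hodd (.inr f) fun ⟨_, _, e⟩ => by cases e]
    exact hR (.inr f)
  measure i := by
    have := hR (.inl i)
    rw [targetLabel_inl] at this
    rw [hrun.sum_kick_eq_oddSum, add_assoc, ZMod.add_self_two, add_zero]
    exact this
  output_left o ho := by
    have := hR (.inl o)
    rw [targetLabel_of_mem_outputs ho] at this
    rw [(Submodule.mem_bot _).mp this]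
    rfl
  output_right o ho := by
    have := hR (.inl o)
    rw [targetLabel_of_mem_outputs ho] at this
    rw [hrun.sum_kick_eq_oddSum, add_assoc, ZMod.add_self_two, add_zero,
      (Submodule.mem_bot _).mp this]
    rfl

/-- There is no obstruction to correcting `v`: a Pauli operator that satisfies the equations of a
stabilizer away from the inputs, is compatible with the labels, and is trivial on all vertices after
`v` commutes with the operator that flips the outcome at `v`. -/
lemma pairing_eq_zero (hrun : P.Runnable)
    (hdet : ∀ β, (P.withAngles β).StronglyDeterministicOnSuccess) {v : V ⊕ F} {l : MeasLabel}
    (hv : P.targetLabel v = some l) {R : V ⊕ F → ZMod 2 × ZMod 2}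
    (hR : ∀ u, R u ∈ (P.targetLabel u).elim ⊥ MeasLabel.compatible)
    (hzero : ∀ u, P.rank v < P.rank u → R u = 0)
    (hodd : ∀ u ∉ P.network.target.inputs,
      (R u).2 = oddSum P.network.target.graph (fun w => (R w).1) u) :
    l.pairing (R v) = 0 := by
  have hweb := isClosedWeb_of_eq_oddSum hrun hR hodd
  have e : ∀ u, ((R (.inl u)).2 + oddSum P.network.target.graph (fun w => (R w).1) (.inl u)) +
      (P.commands.map (P.kick fun w => (R w).1)).sum u = (R (.inl u)).2 := fun u => by
    rw [hrun.sum_kick_eq_oddSum, add_assoc, ZMod.add_self_two, add_zero]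
  have planar : ∀ j, (P.label j).IsPlanar → 0 < P.rank (.inl j) := fun j hj => by
    rw [rank_of_isPlanar hj]
    exact Nat.succ_pos _
  have trivial : ∀ j : {v : V // v ∉ P.outputs}, P.rank v < P.rank (.inl j) →
      (R (.inl j)).1 = 0 ∧ ((R (.inl j)).2 +
        oddSum P.network.target.graph (fun w => (R w).1) (.inl j)) +
        (P.commands.map (P.kick fun w => (R w).1)).sum j = 0 := fun j hj => by
    rw [e, hzero _ hj]
    exact ⟨rfl, rfl⟩
  rcases v with v | f
  · have hvo : v ∉ P.outputs := fun h => by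
      rw [targetLabel_of_mem_outputs h] at hv
      cases hv
    rw [targetLabel_inl ⟨v, hvo⟩, Option.some_inj] at hv
    subst hv
    obtain ⟨pre, post, h⟩ := List.append_of_mem (P.measured ⟨v, hvo⟩)
    have := hweb.pairing_measure_eq_zero hrun hdet h fun j hj hj' => trivial j <| by
      rcases hj' with hj' | hj'
      · exact hrun.rank_lt_of_mem h hj' hj
      · rw [rank_of_not_isPlanar (i := ⟨v, hvo⟩) hj']
        exact planar j hj
    rwa [e] at this
  · cases hv
    have := hweb.pairing_fuse_eq_zero hrun hdet f fun j hj => trivial j (planar j hj)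
    rwa [← oddSum_inr (fun w => (R w).1), ← hodd (.inr f) fun ⟨_, _, e⟩ => by cases e] at this

/-- The indicator `K` of a correction set for `v`: the product of the stabilizers of its elements
flips the outcome at `v`, and preserves the outcomes of all other vertices that do not come
after `v`. -/
lemma exists_correction_indicator (hrun : P.Runnable)
    (hdet : ∀ β, (P.withAngles β).StronglyDeterministicOnSuccess) (v : V ⊕ F) :
    ∃ K : V ⊕ F → ZMod 2, (∀ u ∈ P.network.target.inputs, K u = 0) ∧
      (∀ l, P.targetLabel v = some l → ∀ r ∈ l.compatible,
        r.1 * oddSum P.network.target.graph K v + r.2 * K v = l.pairing r) ∧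
      ∀ w l, P.targetLabel v ≠ none → w ≠ v → P.targetLabel w = some l → ¬ P.rank v < P.rank w →
        ∀ r ∈ l.compatible, r.1 * oddSum P.network.target.graph K w + r.2 * K w = 0 := by
  classical
  cases hv : P.targetLabel v with
  | none =>
    exact ⟨0, fun _ _ => rfl, fun l hl => (Option.some_ne_none l hl.symm).elim,
      fun _ _ h => absurd rfl h⟩
  | some l =>
    let L : V ⊕ F → Submodule (ZMod 2) (ZMod 2 × ZMod 2) := fun u =>
      if P.rank v < P.rank u then ⊥ else (P.targetLabel u).elim ⊥ MeasLabel.compatible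
    have hL : ∀ u l', P.targetLabel u = some l' → ¬ P.rank v < P.rank u → L u = l'.compatible :=
      fun u l' hl' hu => by simp only [L, if_neg hu, hl', Option.elim_some]
    obtain ⟨K, hK, H⟩ := exists_correction P.network.target.graph P.network.target.inputs L
      (Pi.single v l.flip) fun R hR hodd => by
        rw [Finset.sum_eq_single v (fun u _ hu => by simp [hu]) (by simp), Pi.single_eq_same,
          ← MeasLabel.pairing_eq]
        refine pairing_eq_zero hrun hdet hv (fun u => ?_) (fun u hu => ?_) hodd
        · have := hR u
          simp only [L] at this
          split_ifs at this
          · rw [(Submodule.mem_bot _).mp this]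
            exact Submodule.zero_mem _
          · exact this
        · have := hR u
          simp only [L, if_pos hu] at this
          exact (Submodule.mem_bot _).mp this
    refine ⟨K, hK, fun l' hl' r hr => ?_, fun w l' _ hw hl' hlt r hr => ?_⟩
    · obtain rfl := Option.some_injective _ hl'
      rw [H v r (by rw [hL v l hv (lt_irrefl _)]; exact hr), Pi.single_eq_same,
        MeasLabel.pairing_eq]
    · rw [H w r (by rw [hL w l' hl' hlt]; exact hr), Pi.single_eq_of_ne hw]
      simp

/-- Strong determinism on success for all angles yields an XY-flow. -/
theorem hasXYFlow (hrun : P.Runnable)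
    (hdet : ∀ β, (P.withAngles β).StronglyDeterministicOnSuccess) : P.network.HasXYFlow := by
  choose K hin hself hother using P.exists_correction_indicator hrun hdet
  have ne_none : ∀ {v}, v ∉ P.network.target.outputs → P.targetLabel v ≠ none := fun hv => by
    obtain ⟨l, hl⟩ := exists_targetLabel hv
    rw [hl]
    exact Option.some_ne_none l
  -- the label of a vertex that does not come after `v`
  have label : ∀ {v w}, v ∉ P.network.target.outputs → ¬ P.rank v < P.rank w →
      ∃ l, P.targetLabel w = some l := fun {v w} hv hlt => by
    obtain ⟨l, hl⟩ := exists_targetLabel hv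
    exact Option.ne_none_iff_exists'.mp fun hw => hlt (rank_lt_of_targetLabel hl hw)
  have mem_odd : ∀ v w, w ∈ oddNbhd P.network.target.graph {u | K v u = 1} ↔
      oddSum P.network.target.graph (K v) w = 1 := fun v w => mem_oddNbhd_iff _ _ _
  have ne_one : ∀ {c : ZMod 2}, c = 0 → c ≠ 1 := by decide
  have odd_eq_zero : ∀ {v w l}, v ∉ P.network.target.outputs → w ≠ v →
      P.targetLabel w = some l → ¬ P.rank v < P.rank w → l ≠ .Y → l ≠ .Z →
      oddSum P.network.target.graph (K v) w = 0 := fun hv hw hl hlt h1 h2 => by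
    have := hother _ _ _ (ne_none hv) hw hl hlt _ (MeasLabel.one_zero_mem_compatible h1 h2)
    simpa only [one_mul, zero_mul, add_zero] using this
  refine ⟨fun v => {w | K v w = 1}, fun v w => P.rank v < P.rank w, ?_, ?_⟩
  · refine ⟨?_, ?_, ?_, ?_, ?_, ?_, ?_, ?_, ?_, ?_, ?_⟩
    · exact { irrefl := fun v => lt_irrefl _, trans := fun u v w => lt_trans }
    · exact fun v _ w hw hi => ne_one (hin v w hi) hw
    · intro v hv w hw hX hY hvw
      by_contra hlt
      obtain ⟨l, hl⟩ := label hv hlt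
      have := hother v w l (ne_none hv) hvw.symm hl hlt _
        (MeasLabel.zero_one_mem_compatible (fun e => hX ((hasLabel_iff _ _).mpr (e ▸ hl)))
          fun e => hY ((hasLabel_iff _ _).mpr (e ▸ hl)))
      simp only [one_mul, zero_mul, zero_add] at this
      exact ne_one this hw
    · intro v hv w hw hY hZ hvw
      by_contra hlt
      obtain ⟨l, hl⟩ := label hv hlt
      exact ne_one (odd_eq_zero hv hvw.symm hl hlt
        (fun e => hY ((hasLabel_iff _ _).mpr (e ▸ hl)))
        fun e => hZ ((hasLabel_iff _ _).mpr (e ▸ hl))) ((mem_odd v w).mp hw)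
    · intro v hv w hlt hvw hY
      have := hother v w _ (ne_none hv) hvw.symm ((hasLabel_iff _ _).mp hY) hlt _
        MeasLabel.one_one_mem_compatible
      rw [mem_odd]
      simp only [one_mul] at this
      rw [Set.mem_ofPred_eq]
      generalize oddSum P.network.target.graph (K v) w = c at this ⊢
      generalize K v w = d at this ⊢
      revert c d
      decide
    · intro v hv
      have h := hself v _ ((hasLabel_iff _ _).mp hv)
      have h1 := h (1, 0) trivial
      have h2 := h (0, 1) trivial
      simp only [MeasLabel.pairing, one_mul, zero_mul, add_zero, zero_add] at h1 h2
      exact ⟨ne_one h2, (mem_odd v v).mpr h1⟩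
    · intro v hv
      have h := hself v _ ((hasLabel_iff _ _).mp hv)
      have h1 := h (1, 0) trivial
      have h2 := h (0, 1) trivial
      simp only [MeasLabel.pairing, one_mul, zero_mul, add_zero, zero_add] at h1 h2
      exact ⟨h2, (mem_odd v v).mpr h1⟩
    · intro v hv
      have h := hself v _ ((hasLabel_iff _ _).mp hv)
      have h1 := h (1, 0) trivial
      have h2 := h (0, 1) trivial
      simp only [MeasLabel.pairing, one_mul, zero_mul, add_zero, zero_add] at h1 h2
      exact ⟨h2, fun h3 => ne_one h1 ((mem_odd v v).mp h3)⟩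
    · intro v hv
      have h1 := hself v _ ((hasLabel_iff _ _).mp hv) (1, 0)
        (MeasLabel.one_zero_mem_compatible (by simp) (by simp))
      simp only [MeasLabel.pairing, one_mul, zero_mul, add_zero] at h1
      exact (mem_odd v v).mpr h1
    · intro v hv
      have h2 := hself v _ ((hasLabel_iff _ _).mp hv) (0, 1)
        (MeasLabel.zero_one_mem_compatible (by simp) (by simp))
      simp only [MeasLabel.pairing, one_mul, zero_mul, zero_add] at h2
      exact h2
    · intro v hv
      have := hself v _ ((hasLabel_iff _ _).mp hv) _
        MeasLabel.one_one_mem_compatible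
      rw [mem_odd]
      simp only [MeasLabel.pairing, one_mul] at this
      rw [Set.mem_ofPred_eq]
      generalize oddSum P.network.target.graph (K v) v = c at this ⊢
      generalize K v v = d at this ⊢
      revert c d
      decide
  · intro f hf v hv hvf h
    have hl : P.targetLabel (.inr f) = some .X := by
      change P.fusionLabel f = .X at hf
      rw [targetLabel, hf]
      rfl
    exact ne_one (odd_eq_zero hv hvf.symm hl (Nat.not_lt_zero _) (by simp) (by simp))
      ((mem_odd v _).mp h)

end Flow

end XYFusionPattern

theorem mainTheorem7 {V F : Type*} [Fintype V] [DecidableEq V] [Fintype F]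
    (P : XYFusionPattern V F) (hrun : P.Runnable)
    (hdet : ∀ β : {v : V // v ∉ P.outputs} → MeasAngle,
      (P.withAngles β).StronglyDeterministicOnSuccess ∧
        (P.withAngles β).StepwiseDeterministicOnSuccess) :
    P.network.HasXYFlow :=
  P.hasXYFlow hrun fun β => (hdet β).1
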